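/- Let $\mathcal J_1$ be the space of trace class operators on $L^2(\mathbb R^3)$ (complex-valued functions), with norm $\|A\|_1=\operatorname{tr}|A|$, and let $\mathcal J_1^s\subset\mathcal J_1$ be the self-adjoint ones. Let $\Lambda:=\sqrt{1-\Delta+|x|^2}$, the positive square root of the self-adjoint operator $1-\Delta+|x|^2$ on $L^2(\mathbb R^3)$ (the operator of the closure of the quadratic form $\|f\|_2^2+\|\nabla f\|_2^2+\||x|f\|_2^2$ on Schwartz functions), and define the energy space $$\mathcal E:=\{\rho\in\mathcal J_1^s:\ \Lambda\rho\Lambda\in\mathcal J_1^s\},\qquad \|\rho\|_{\mathcal E}:=\|\Lambda\rho\Lambda\|_1 ,$$ where $\Lambda\rho\Lambda\in\mathcal J_1^s$ means that $\Lambda\rho\Lambda$ is defined on the domain of $\Lambda$ and is there the restriction of an operator in $\mathcal J_1^s$; the norm formula is also used for bounded $\rho$ that need not be self-adjoint. For $\rho\in\mathcal E$ with integral kernel $\rho(\cdot,\cdot)\in L^2(\mathbb R^3\times\mathbb R^3)$ let the particle density be $$n[\rho](x):=\lim_{\varepsilon\downarrow0}\int_{\mathbb R^3}\rho\left(x+\tfrac\eta2,x-\tfrac\eta2\right)\frac{e^{-|\eta|^2/(2\varepsilon)}}{(2\pi\varepsilon)^{3/2}}\,d\eta\quad\text{(limit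 in } L^1(\mathbb R^3)),$$ and let the Hartree potential be $$\phi[\rho](x):=\frac1{4\pi}\int_{\mathbb R^3}\frac{n[\rho](y)}{|x-y|}\,dy ,$$ which also denotes the operator of multiplication by this function. Write $[A,B]=AB-BA$. Then: 1. For every $\rho\in\mathcal E$ the kernel and the limit defining $n[\rho]\in L^1(\mathbb R^3)$ exist, the integral defining $\phi[\rho](x)$ converges absolutely for every $x\in\mathbb R^3$, and $\phi[\rho]\in L^\infty(\mathbb R^3)$. 2. The map $\rho\mapsto -i[\phi[\rho],\rho]$ maps $\mathcal E$ into itself and is locally Lipschitz, in the sense of Lipschitz continuity on bounded sets: for every $R\ge0$ there is $L\ge 0$ such that $$\big\|\,i[\phi[\rho_1],\rho_1]-i[\phi[\rho_2],\rho_2]\,\big\|_{\mathcal E}\le L\,\|\rho_1-\rho_2\|_{\mathcal E}\qquad\text{for all }\rho_1,\rho_2\in\mathcal E\text{ with }\|\rho_1\|_{\mathcal E},\|\rho_2\|_{\mathcal E}\le R .$$ 3. There is a constant $C\ge 0$ such that $\|[\phi[\rho],\rho]\|_{\mathcal E}\le C\,\|\rho\|_{\mathcal E}^2$ for all $\rho\in\mathcal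 E$. -/

import Mathlib

open MeasureTheory Filter Topology
open scoped ENNReal NNReal SchwartzMap LineDeriv InnerProductSpace

noncomputable section

namespace QDS

/-- Three-dimensional Euclidean space with its Lebesgue measure `volume`. -/
abbrev R3 : Type := EuclideanSpace ℝ (Fin 3)

/-- The Hilbert space `L²(ℝ³)` of complex-valued functions. -/
abbrev L2 : Type := Lp ℂ 2 (volume : Measure R3)

/-- The bounded operators on `L²(ℝ³)`. -/
abbrev Op : Type := L2 →L[ℂ] L2

/-! ### Trace class operators and square roots -/

section Operators

variable {H : Type*} [NormedAddCommGroup H] [InnerProductSpace ℂ H] [CompleteSpace H]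

/-- The index set of a fixed orthonormal basis of `H`. -/
def basisIndex (H : Type*) [NormedAddCommGroup H] [InnerProductSpace ℂ H] [CompleteSpace H] :
    Set H :=
  (exists_hilbertBasis ℂ H).choose

/-- A fixed orthonormal basis of `H`. -/
def basis (H : Type*) [NormedAddCommGroup H] [InnerProductSpace ℂ H] [CompleteSpace H] :
    HilbertBasis (basisIndex H) ℂ H :=
  (exists_hilbertBasis ℂ H).choose_spec.choose

/-- The trace `∑ᵢ ⟨eᵢ, T eᵢ⟩ ∈ [0, ∞]` of a positive operator `T`
(the value does not depend on the orthonormal basis). -/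
def posTrace (T : H →L[ℂ] H) : ℝ≥0∞ :=
  ∑' i, ENNReal.ofReal (RCLike.re ⟪basis H i, T (basis H i)⟫_ℂ)

/-- The trace norm `tr |A|`, where `|A| = (A* A)^{1/2}`; it is `∞` if `A` is not trace class. -/
def traceNorm (A : H →L[ℂ] H) : ℝ≥0∞ :=
  posTrace (CFC.abs A)

/-- The space `J₁ˢ` of self-adjoint trace class operators. -/
def IsSelfAdjointTraceClass (A : H →L[ℂ] H) : Prop :=
  IsSelfAdjoint A ∧ traceNorm A < ∞

/-- The positive square root of a positive bounded operator. -/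
def opSqrt (T : H →L[ℂ] H) : H →L[ℂ] H :=
  CFC.sqrt T

end Operators

/-! ### The operator `Λ = (1 - Δ + |x|²)^{1/2}` -/

/-- Multiplication of Schwartz functions by the `i`-th coordinate. -/
def coordMul (i : Fin 3) : 𝓢(R3, ℂ) →L[ℂ] 𝓢(R3, ℂ) :=
  SchwartzMap.smulLeftCLM ℂ (fun x : R3 => ((x i : ℝ) : ℂ))

/-- Partial derivative of Schwartz functions in the `i`-th coordinate. -/
def coordDeriv (i : Fin 3) : 𝓢(R3, ℂ) →L[ℂ] 𝓢(R3, ℂ) :=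
  LineDeriv.lineDerivOpCLM ℂ 𝓢(R3, ℂ) (EuclideanSpace.single i (1 : ℝ))

/-- The seven components `f`, `∂ᵢ f`, `xᵢ f` of the energy form. -/
def formComponent : Unit ⊕ Fin 3 ⊕ Fin 3 → (𝓢(R3, ℂ) →L[ℂ] 𝓢(R3, ℂ))
  | .inl _ => ContinuousLinearMap.id ℂ _
  | .inr (.inl i) => coordDeriv i
  | .inr (.inr i) => coordMul i

/-- The Hilbert space `L² ⊕ (L²)³ ⊕ (L²)³`. -/
abbrev FormAmbient : Type := PiLp 2 (fun _ : Unit ⊕ Fin 3 ⊕ Fin 3 => L2)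

/-- The map `f ↦ (f, ∇f, x f)` on Schwartz functions. Its norm squared is
`‖f‖² + ‖∇f‖² + ‖x f‖² = ⟨f, (1 - Δ + |x|²) f⟩`. -/
def formMap : 𝓢(R3, ℂ) →ₗ[ℂ] FormAmbient where
  toFun f := WithLp.toLp 2 fun j => SchwartzMap.toLpCLM ℂ ℂ 2 volume (formComponent j f)
  map_add' f g := by
    apply PiLp.ext
    intro j
    simp only [map_add, PiLp.add_apply]
  map_smul' c f := by
    apply PiLp.ext
    intro j
    simp only [map_smul, PiLp.smul_apply, RingHom.id_apply]

/-- The form domain of `1 - Δ + |x|²`, i.e. the completion of the Schwartz functions in the norm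
`(‖f‖² + ‖∇f‖² + ‖x f‖²)^{1/2}`, realized as a closed subspace of `L² ⊕ (L²)³ ⊕ (L²)³`. -/
def formDomain : Submodule ℂ FormAmbient :=
  (LinearMap.range formMap).topologicalClosure

instance : CompleteSpace formDomain :=
  (Submodule.isClosed_topologicalClosure _).completeSpace_coe

/-- The embedding of the form domain into `L²(ℝ³)`. -/
def formEmbed : formDomain →L[ℂ] L2 :=
  (PiLp.proj 2 (fun _ : Unit ⊕ Fin 3 ⊕ Fin 3 => L2) (Sum.inl ()) : FormAmbient →L[ℂ] L2) ∘L
    formDomain.subtypeL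

/-- The bounded inverse `(1 - Δ + |x|²)⁻¹` of the self-adjoint operator `1 - Δ + |x|²` associated
with the closed energy form `q`: for `g ∈ L²` it yields the `u` in the form domain with
`q(u, v) = ⟨g, v⟩` for all `v` in the form domain. -/
def oscillatorInv : Op :=
  formEmbed ∘L ContinuousLinearMap.adjoint formEmbed

/-- The bounded operator `Λ⁻¹ = (1 - Δ + |x|²)^{-1/2}`. -/
def lamInv : Op :=
  opSqrt oscillatorInv

/-- The unbounded self-adjoint operator `Λ = (1 - Δ + |x|²)^{1/2}`. -/
def lam : L2 →ₗ.[ℂ] L2 :=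
  ((lamInv : L2 →ₗ[ℂ] L2).toPMap ⊤).inverse

/-! ### The energy space -/

/-- The operator `Λ ρ Λ`, with domain `D(Λ)`, is given by the bounded operator `σ`. -/
def IsLamConj (ρ σ : Op) : Prop :=
  ∀ f : lam.domain, ∃ h : ρ (lam f) ∈ lam.domain, lam ⟨ρ (lam f), h⟩ = σ f

/-- The energy space: all `ρ ∈ J₁ˢ` such that `Λ ρ Λ ∈ J₁ˢ`. -/
def energySpace : Set Op :=
  {ρ | IsSelfAdjointTraceClass ρ ∧ ∃ σ, IsLamConj ρ σ ∧ IsSelfAdjointTraceClass σ}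

/-- The energy norm `tr |Λ ρ Λ|`; it is `∞` if `Λ ρ Λ` is not (the restriction of) a
bounded operator. The bounded operator `σ` is unique, since `D(Λ)` is dense. -/
def energyNorm (ρ : Op) : ℝ≥0∞ :=
  ⨅ (σ : Op) (_ : IsLamConj ρ σ), traceNorm σ

/-! ### Particle density, Hartree potential and the commutator -/

/-- `k ∈ L²(ℝ³ × ℝ³)` is the integral kernel of the operator `ρ`. -/
def IsKernel (ρ : Op) (k : R3 × R3 → ℂ) : Prop :=
  MemLp k 2 (volume : Measure (R3 × R3)) ∧
    ∀ f : L2, ∀ᵐ x : R3, ρ f x = ∫ y : R3, k (x, y) * f y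

/-- The regularized diagonal
`x ↦ ∫ k(x + η/2, x - η/2) (2πε)^{-3/2} exp(-|η|²/(2ε)) dη` of a kernel `k`. -/
def mollDiag (k : R3 × R3 → ℂ) (ε : ℝ) (x : R3) : ℂ :=
  ∫ η : R3, k (x + (2⁻¹ : ℝ) • η, x - (2⁻¹ : ℝ) • η) *
    ((Real.exp (-‖η‖ ^ 2 / (2 * ε)) / (2 * Real.pi * ε) ^ ((3 : ℝ) / 2) : ℝ) : ℂ)

/-- `n ∈ L¹(ℝ³)` is the particle density of `ρ`: the `L¹`-limit, as `ε → 0`, of the regularized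
diagonals of the kernel of `ρ`. -/
def IsDensity (ρ : Op) (n : R3 → ℂ) : Prop :=
  Integrable n ∧ ∃ k, IsKernel ρ k ∧
    Tendsto (fun ε : ℝ => eLpNorm (fun x => mollDiag k ε x - n x) 1 volume) (𝓝[>] 0) (𝓝 0)

open Classical in
/-- The particle density `n[ρ]` (determined up to null sets when it exists). -/
def density (ρ : Op) : R3 → ℂ :=
  if h : ∃ n, IsDensity ρ n then h.choose else 0

/-- The Hartree potential `φ[ρ](x) = (4π)⁻¹ ∫ n[ρ](y) / |x - y| dy`. -/
def hartree (ρ : Op) (x : R3) : ℂ :=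
  (4 * Real.pi : ℂ)⁻¹ * ∫ y : R3, density ρ y / ((‖x - y‖ : ℝ) : ℂ)

open Classical in
/-- Multiplication by a function `φ ∈ L^∞(ℝ³)` as a bounded operator on `L²(ℝ³)`. -/
def mulOp (φ : R3 → ℂ) : Op :=
  if h : MemLp φ ∞ volume then
    (ContinuousLinearMap.mul ℂ ℂ).holderL volume ∞ 2 2 h.toLp
  else 0

/-- The commutator `[φ[ρ], ρ]`. -/
def hartreeCommutator (ρ : Op) : Op :=
  mulOp (hartree ρ) * ρ - ρ * mulOp (hartree ρ)

end QDS

end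

/-!
With `S = Λ⁻¹`, the energy space consists of the operators `ρ = S σ S` with `σ` self-adjoint and
trace class, and `‖ρ‖_E = tr |σ|` (`isLamConj_iff`, `mem_energySpace_iff`,
`energyNorm_lamInv_conj`). The theorem rests on three facts.

*Density.* Write `σ = Q T` with the commuting self-adjoint Hilbert–Schmidt operators
`Q = |σ|^{1/2}` and `T = sgn(σ) |σ|^{1/2}` (`exists_hilbertSchmidt_factorization`). The kernel of
`ρ = (S Q) (S T)*` is `∑ᵢ uᵢ(x) conj (vᵢ(y))` with `uᵢ = S Q eᵢ` and `vᵢ = S T eᵢ`, that is,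
`⟪V y, U x⟫` for two functions `U`, `V` in `L²(ℝ³; L²)`. Continuity of translations in that space
shows that the regularized diagonals converge in `L¹` to `n(x) = ⟪V x, U x⟫`
(`isDensity_mul_adjoint`). Since also `σ = T Q`, the density is real. It is unique because the
kernel is (`IsDensity.ae_eq`), hence linear in `ρ`.

*Potential.* Hardy's inequality `∫ |f(y)|² / |x - y|² dy ≤ 4 ‖∇f‖²` on the form domain reads
`∫ |S g (y)|² / |x - y|² dy ≤ 4 ‖g‖²` (`hardy_lamInv`). Summed over the `uᵢ` and `vᵢ` it gives
`∫ |n(y)| / |x - y|² dy ≤ 4 tr |σ|` for every `x` (`exists_isDensity_lamInv_conj`). From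
`1/r ≤ (1 + 1/r²)/2` and `|1/r - 1/r'| ≤ |x - x'| (1/r² + 1/r'²)/2` it follows that `φ[ρ]` is
bounded by `tr |σ|` and Lipschitz with constant `tr |σ|`
(`HardyBound.norm_coulomb_le`, `HardyBound.norm_coulomb_sub_le`).

*Commutator.* A bounded Lipschitz function `φ` maps the form domain, which is the domain of `Λ`,
into itself, so `φ S = S B` with `B` bounded (`exists_mulOp_mul_lamInv`). For real `φ` this gives
`[φ, S σ S] = S (B σ - σ B*) S`, whose energy norm is at most `2 ‖B‖ tr |σ|`
(`exists_commutator_eq_lamInv_conj`). With `‖B‖` bounded by a multiple of `‖ρ‖_E` this is the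
quadratic bound. The Lipschitz bound follows by bilinearity:
`[φ₁, ρ₁] - [φ₂, ρ₂] = [φ₁ - φ₂, ρ₁] + [φ₂, ρ₁ - ρ₂]`.

The triangle and Hölder inequalities for the trace norm are obtained from a dual description of
it (`TraceBound`), which replaces the polar decomposition by an approximate one.
-/

noncomputable section

namespace QDS

/-! ### Hilbert–Schmidt operators and the trace norm -/

section HilbertSchmidt

variable {H : Type*} [NormedAddCommGroup H] [InnerProductSpace ℂ H] [CompleteSpace H]

/-- The square `∑ᵢ ‖A eᵢ‖²` of the Hilbert–Schmidt norm, with values in `[0, ∞]`. -/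
def hsSq (A : H →L[ℂ] H) : ℝ≥0∞ :=
  ∑' i, ‖A (basis H i)‖ₑ ^ 2

/-- Parseval's identity in `[0, ∞]`. -/
lemma tsum_enorm_inner_sq (x : H) : ∑' i, ‖⟪basis H i, x⟫_ℂ‖ₑ ^ 2 = ‖x‖ₑ ^ 2 := by
  have hs := (basis H).summable_inner_mul_inner x x
  have h := (basis H).tsum_inner_mul_inner x x
  have e : ∀ i, ⟪x, basis H i⟫_ℂ * ⟪basis H i, x⟫_ℂ = ((‖⟪basis H i, x⟫_ℂ‖ ^ 2 : ℝ) : ℂ) := by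
    intro i
    rw [← inner_conj_symm x, RCLike.conj_mul]
    norm_cast
  simp only [e] at h hs
  rw [← Complex.ofReal_tsum, inner_self_eq_norm_sq_to_K] at h
  have h' : ∑' i, ‖⟪basis H i, x⟫_ℂ‖ ^ 2 = ‖x‖ ^ 2 := by
    exact Complex.ofReal_injective (by simpa using h)
  have hs' : Summable fun i => ‖⟪basis H i, x⟫_ℂ‖ ^ 2 := by exact_mod_cast hs
  have := congrArg ENNReal.ofReal h'
  rw [ENNReal.ofReal_tsum_of_nonneg (fun _ => by positivity) hs'] at this
  simpa [ENNReal.ofReal_pow] using this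

lemma hsSq_adjoint (A : H →L[ℂ] H) : hsSq (ContinuousLinearMap.adjoint A) = hsSq A := by
  simp only [hsSq, ← tsum_enorm_inner_sq (_ : H)]
  rw [ENNReal.tsum_comm]
  refine tsum_congr fun i => tsum_congr fun j => ?_
  rw [ContinuousLinearMap.adjoint_inner_right, ← inner_conj_symm, RCLike.enorm_conj]

lemma hsSq_comp_left (B A : H →L[ℂ] H) : hsSq (B * A) ≤ ‖B‖ₑ ^ 2 * hsSq A := by
  simp only [hsSq, ← ENNReal.tsum_mul_left, ← mul_pow]
  gcongr with i
  exact B.le_opENorm _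

lemma hsSq_comp_right (A B : H →L[ℂ] H) : hsSq (A * B) ≤ ‖B‖ₑ ^ 2 * hsSq A := by
  rw [← hsSq_adjoint, ← hsSq_adjoint A]
  have : ContinuousLinearMap.adjoint (A * B) =
      ContinuousLinearMap.adjoint B * ContinuousLinearMap.adjoint A :=
    ContinuousLinearMap.adjoint_comp A B
  rw [this]
  refine (hsSq_comp_left _ _).trans_eq ?_
  rw [← ofReal_norm, ← ofReal_norm, LinearIsometryEquiv.norm_map]

/-- A dual form of `tr |X| ≤ M`: all finite partial sums of the traces `Re tr (W* X)`,
over contractions `W`, are at most `M`. Unlike the trace norm, this bound is visibly additive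
in `X`. -/
def TraceBound (X : H →L[ℂ] H) (M : ℝ) : Prop :=
  ∀ W : H →L[ℂ] H, ‖W‖ ≤ 1 → ∀ F : Finset (basisIndex H),
    ∑ i ∈ F, RCLike.re ⟪W (basis H i), X (basis H i)⟫_ℂ ≤ M

lemma TraceBound.add {X Y : H →L[ℂ] H} {M N : ℝ} (hX : TraceBound X M) (hY : TraceBound Y N) :
    TraceBound (X + Y) (M + N) := by
  intro W hW F
  have := add_le_add (hX W hW F) (hY W hW F)
  simpa [inner_add_right, Finset.sum_add_distrib] using this

lemma TraceBound.smul {X : H →L[ℂ] H} {M : ℝ} (hX : TraceBound X M) {c : ℂ} (hc : ‖c‖ = 1) :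
    TraceBound (c • X) M := by
  intro W hW F
  have := hX (star c • W) (by simpa [norm_smul, hc] using hW) F
  simpa [inner_smul_left, inner_smul_right, mul_comm] using this

lemma TraceBound.neg {X : H →L[ℂ] H} {M : ℝ} (hX : TraceBound X M) : TraceBound (-X) M := by
  simpa using hX.smul (c := -1) (by simp)

lemma TraceBound.sub {X Y : H →L[ℂ] H} {M N : ℝ} (hX : TraceBound X M) (hY : TraceBound Y N) :
    TraceBound (X - Y) (M + N) := by
  rw [sub_eq_add_neg]; exact hX.add hY.neg

/-- The Cauchy–Schwarz inequality: `tr |A D*| ≤ ‖A‖₂ ‖D‖₂` for Hilbert–Schmidt operators. -/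
lemma traceBound_mul_adjoint {A D : H →L[ℂ] H} {a d : ℝ} (ha : 0 ≤ a) (hd : 0 ≤ d)
    (hA : hsSq A ≤ ENNReal.ofReal (a ^ 2)) (hD : hsSq D ≤ ENNReal.ofReal (d ^ 2)) :
    TraceBound (A * ContinuousLinearMap.adjoint D) (a * d) := by
  have key : ∀ (B : H →L[ℂ] H) (b : ℝ), 0 ≤ b → hsSq B ≤ ENNReal.ofReal (b ^ 2) →
      ∀ F : Finset (basisIndex H), √(∑ i ∈ F, ‖B (basis H i)‖ ^ 2) ≤ b := by
    intro B b hb hB F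
    refine Real.sqrt_le_iff.2 ⟨hb, ?_⟩
    rw [← ENNReal.ofReal_le_ofReal_iff (by positivity)]
    refine le_trans ?_ hB
    rw [ENNReal.ofReal_sum_of_nonneg (fun _ _ => by positivity)]
    refine le_trans (le_of_eq ?_) (ENNReal.sum_le_tsum F)
    refine Finset.sum_congr rfl fun i _ => ?_
    rw [ENNReal.ofReal_pow (norm_nonneg _), ofReal_norm]
  intro W hW F
  set A' := ContinuousLinearMap.adjoint A * W with hA'
  set D' := ContinuousLinearMap.adjoint D with hD'
  have hWe : ‖W‖ₑ ≤ 1 := by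
    rw [← ofReal_norm]; exact ENNReal.ofReal_le_one.2 hW
  have h1 : hsSq A' ≤ ENNReal.ofReal (a ^ 2) := by
    refine (hsSq_comp_right _ _).trans ?_
    rw [hsSq_adjoint]
    refine (mul_le_mul' (pow_le_pow_left' hWe 2) hA).trans ?_
    simp
  have h2 : hsSq D' ≤ ENNReal.ofReal (d ^ 2) := by rwa [hD', hsSq_adjoint]
  calc ∑ i ∈ F, RCLike.re ⟪W (basis H i), (A * D') (basis H i)⟫_ℂ
      ≤ ∑ i ∈ F, ‖A' (basis H i)‖ * ‖D' (basis H i)‖ := by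
        gcongr with i
        rw [mul_apply_eq_comp, ← ContinuousLinearMap.adjoint_inner_left]
        exact (RCLike.re_le_norm _).trans (norm_inner_le_norm _ _)
    _ ≤ √(∑ i ∈ F, ‖A' (basis H i)‖ ^ 2) * √(∑ i ∈ F, ‖D' (basis H i)‖ ^ 2) :=
        Real.sum_mul_le_sqrt_mul_sqrt _ _ _
    _ ≤ a * d := by
        gcongr
        · exact key A' a ha h1 F
        · exact key D' d hd h2 F

/-- A quantitative polar decomposition: since the polar isometry of `X` need not be a continuous
function of `X`, it is replaced by the contraction `X (|X| + δ)⁻¹`. -/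
lemma exists_approx_polar (X : H →L[ℂ] H) {δ : ℝ} (hδ : 0 < δ) :
    ∃ W : H →L[ℂ] H, ‖W‖ ≤ 1 ∧ ∀ e : H,
      RCLike.re ⟪e, CFC.abs X e⟫_ℂ ≤ RCLike.re ⟪W e, X e⟫_ℂ + δ * ‖e‖ ^ 2 := by
  set P := CFC.abs X with hP
  have hP0 : 0 ≤ P := CFC.abs_nonneg X
  have hPsa : IsSelfAdjoint P := IsSelfAdjoint.of_nonneg hP0
  have hPP : P * P = star X * X := CFC.abs_mul_abs X
  have hspec : ∀ t ∈ spectrum ℝ P, 0 ≤ t := fun t ht => spectrum_nonneg_of_nonneg hP0 ht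
  have hne : ∀ t ∈ spectrum ℝ P, t + δ ≠ 0 := fun t ht => by have := hspec t ht; positivity
  have hc : ContinuousOn (fun t : ℝ => (t + δ)⁻¹) (spectrum ℝ P) :=
    ContinuousOn.inv₀ (by fun_prop) hne
  set R := cfc (fun t : ℝ => (t + δ)⁻¹) P with hR
  have hRsa : IsSelfAdjoint R := cfc_predicate _ P
  have hPR : P * R = cfc (fun t : ℝ => t * (t + δ)⁻¹) P := by
    rw [cfc_mul (fun t : ℝ => t) (fun t : ℝ => (t + δ)⁻¹) P (by fun_prop) hc, cfc_id' ℝ P]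
  have hRP : R * P = P * R := by
    rw [hPR, show (fun t : ℝ => t * (t + δ)⁻¹) = fun t => (t + δ)⁻¹ * t from
      funext fun t => mul_comm _ _,
      cfc_mul (fun t : ℝ => (t + δ)⁻¹) (fun t : ℝ => t) P hc (by fun_prop),
      cfc_id' ℝ P]
  have hPRnorm : ‖P * R‖ ≤ 1 := by
    rw [hPR]
    refine norm_cfc_le zero_le_one fun t ht => ?_
    have := hspec t ht
    rw [Real.norm_of_nonneg (by positivity), ← div_eq_mul_inv, div_le_one (by positivity)]
    linarith
  have hPX : ∀ x y : H, ⟪X x, X y⟫_ℂ = ⟪P x, P y⟫_ℂ := by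
    intro x y
    have h1 : ⟪x, (P * P) y⟫_ℂ = ⟪x, (star X * X) y⟫_ℂ := by rw [hPP]
    rw [mul_apply_eq_comp, mul_apply_eq_comp,
      ContinuousLinearMap.star_eq_adjoint, ContinuousLinearMap.adjoint_inner_right] at h1
    rw [← h1]
    exact (hPsa.isSymmetric _ _).symm
  refine ⟨X * R, ?_, fun e => ?_⟩
  · refine ContinuousLinearMap.opNorm_le_bound _ zero_le_one fun v => ?_
    have h1 : ‖X (R v)‖ = ‖P (R v)‖ := by
      rw [norm_eq_sqrt_re_inner (𝕜 := ℂ), hPX, ← norm_eq_sqrt_re_inner (𝕜 := ℂ)]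
    rw [mul_apply_eq_comp, h1, one_mul]
    exact ((P * R).le_opNorm v).trans (mul_le_of_le_one_left (norm_nonneg _) hPRnorm)
  · have h2 : P - P * R * P = cfc (fun t : ℝ => t - t * (t + δ)⁻¹ * t) P := by
      rw [cfc_sub (fun t : ℝ => t) (fun t : ℝ => t * (t + δ)⁻¹ * t) P (by fun_prop) (by fun_prop),
        cfc_mul (fun t : ℝ => t * (t + δ)⁻¹) (fun t : ℝ => t) P (by fun_prop) (by fun_prop),
        cfc_id' ℝ P, ← hPR]
    have h3 : ‖P - P * R * P‖ ≤ δ := by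
      rw [h2]
      refine norm_cfc_le hδ.le fun t ht => ?_
      have := hspec t ht
      have e : t - t * (t + δ)⁻¹ * t = δ * (t / (t + δ)) := by
        field_simp; ring
      rw [e, Real.norm_of_nonneg (by positivity)]
      refine mul_le_of_le_one_right hδ.le ?_
      rw [div_le_one (by positivity)]
      linarith
    have h4 : ⟪(X * R) e, X e⟫_ℂ = ⟪e, (P * R * P) e⟫_ℂ := by
      rw [mul_apply_eq_comp, hPX, ← hRP]
      exact (hPsa.isSymmetric _ _).trans (hRsa.isSymmetric _ _)
    have h5 : RCLike.re ⟪e, (P - P * R * P) e⟫_ℂ ≤ δ * ‖e‖ ^ 2 := by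
      refine (RCLike.re_le_norm _).trans ((norm_inner_le_norm _ _).trans ?_)
      have := (P - P * R * P).le_of_opNorm_le h3 e
      nlinarith [norm_nonneg e]
    rw [h4]
    rw [sub_apply, inner_sub_right, map_sub] at h5
    linarith

lemma TraceBound.traceNorm_le {X : H →L[ℂ] H} {M : ℝ} (hX : TraceBound X M) :
    traceNorm X ≤ ENNReal.ofReal M := by
  have hpos : ∀ i, 0 ≤ RCLike.re ⟪basis H i, CFC.abs X (basis H i)⟫_ℂ := fun i =>
    ((ContinuousLinearMap.nonneg_iff_isPositive _).1 (CFC.abs_nonneg X)).re_inner_nonneg_right _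
  rw [traceNorm, posTrace, ENNReal.tsum_eq_iSup_sum]
  refine iSup_le fun F => ?_
  rw [← ENNReal.ofReal_sum_of_nonneg fun i _ => hpos i]
  refine ENNReal.ofReal_le_ofReal ?_
  refine le_of_forall_pos_le_add fun ε hε => ?_
  obtain ⟨W, hW, h⟩ := exists_approx_polar X (δ := ε / (F.card + 1)) (by positivity)
  calc _ ≤ ∑ i ∈ F, (RCLike.re ⟪W (basis H i), X (basis H i)⟫_ℂ + ε / (F.card + 1)) := by
        gcongr with i
        simpa [(basis H).orthonormal.norm_eq_one i] using h (basis H i)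
    _ ≤ M + ε := by
        rw [Finset.sum_add_distrib]
        refine add_le_add (hX W hW F) ?_
        rw [Finset.sum_const, nsmul_eq_mul, mul_div_assoc', div_le_iff₀ (by positivity)]
        nlinarith

/-- A self-adjoint trace class operator is the product of the commuting self-adjoint
Hilbert–Schmidt operators `|σ|^{1/2}` and `sgn(σ) |σ|^{1/2}`. -/
lemma exists_hilbertSchmidt_factorization {σ : H →L[ℂ] H} (hσ : IsSelfAdjoint σ) :
    ∃ Q T : H →L[ℂ] H, IsSelfAdjoint Q ∧ IsSelfAdjoint T ∧ Q * T = σ ∧ T * Q = σ ∧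
      hsSq Q = traceNorm σ ∧ hsSq T = traceNorm σ := by
  set q : ℝ → ℝ := fun t => √|t| with hq
  set s : ℝ → ℝ := fun t => √t - √(-t) with hs
  have hqc : Continuous q := by fun_prop
  have hsc : Continuous s := by fun_prop
  have hqs : ∀ t, q t * s t = t := by
    intro t
    rcases le_total 0 t with h | h
    · simp [hq, hs, abs_of_nonneg h, Real.sqrt_eq_zero_of_nonpos (neg_nonpos.2 h), h]
    · simp [hq, hs, abs_of_nonpos h, Real.sqrt_eq_zero_of_nonpos h, h]
  have hqq : ∀ t, q t * q t = |t| := fun t => Real.mul_self_sqrt (abs_nonneg t)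
  have hss : ∀ t, s t * s t = |t| := by
    intro t
    rcases le_total 0 t with h | h
    · simp [hs, abs_of_nonneg h, Real.sqrt_eq_zero_of_nonpos (neg_nonpos.2 h), h]
    · simp [hs, abs_of_nonpos h, Real.sqrt_eq_zero_of_nonpos h, h]
  have hmul : ∀ f g : ℝ → ℝ, Continuous f → Continuous g →
      cfc f σ * cfc g σ = cfc (fun t => f t * g t) σ := fun f g hf hg =>
    (cfc_mul f g σ hf.continuousOn hg.continuousOn).symm
  -- a self-adjoint square root of `|σ|` has Hilbert–Schmidt norm squared `tr |σ|`
  have hhs : ∀ A : H →L[ℂ] H, IsSelfAdjoint A → A * A = CFC.abs σ → hsSq A = traceNorm σ := by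
    intro A hA hAA
    refine tsum_congr fun i => ?_
    rw [← hAA, mul_apply_eq_comp,
      show ⟪basis H i, A (A (basis H i))⟫_ℂ = ⟪A (basis H i), A (basis H i)⟫_ℂ from
      (hA.isSymmetric _ _).symm,
      inner_self_eq_norm_sq, ENNReal.ofReal_pow (norm_nonneg _), ofReal_norm]
  have habs : CFC.abs σ = cfc (fun t : ℝ => |t|) σ := by
    rw [CFC.abs_eq_cfc_norm σ hσ]; rfl
  refine ⟨cfc q σ, cfc s σ, cfc_predicate _ _, cfc_predicate _ _, ?_, ?_,
    hhs _ (cfc_predicate _ _) ?_, hhs _ (cfc_predicate _ _) ?_⟩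
  · rw [hmul q s hqc hsc]; simp only [hqs]; exact cfc_id' ℝ σ
  · rw [hmul s q hsc hqc]; simp only [mul_comm (s _), hqs]; exact cfc_id' ℝ σ
  · rw [hmul q q hqc hqc, habs]; simp only [hqq]
  · rw [hmul s s hsc hsc, habs]; simp only [hss]

end HilbertSchmidt

/-! ### The operator `Λ⁻¹` and the energy space -/

lemma lamInv_nonneg : 0 ≤ lamInv := CFC.sqrt_nonneg _

lemma isSelfAdjoint_lamInv : IsSelfAdjoint lamInv := IsSelfAdjoint.of_nonneg lamInv_nonneg

lemma lamInv_mul_lamInv : lamInv * lamInv = oscillatorInv := by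
  have h0 : (0 : Op) ≤ oscillatorInv := by
    rw [ContinuousLinearMap.nonneg_iff_isPositive]
    exact ContinuousLinearMap.isPositive_self_comp_adjoint formEmbed
  exact CFC.sqrt_mul_sqrt_self _ h0

/-- `Λ⁻¹` and the adjoint of the embedding of the form domain have the same absolute value; this
is how properties of the form domain are transferred to `Λ⁻¹`. -/
lemma norm_lamInv_apply (h : L2) :
    ‖lamInv h‖ = ‖ContinuousLinearMap.adjoint formEmbed h‖ := by
  have : ⟪lamInv h, lamInv h⟫_ℂ = ⟪ContinuousLinearMap.adjoint formEmbed h,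
      ContinuousLinearMap.adjoint formEmbed h⟫_ℂ := by
    refine (isSelfAdjoint_lamInv.isSymmetric _ _).trans ?_
    rw [ContinuousLinearMap.adjoint_inner_left]
    exact congrArg (fun A : Op => ⟪h, A h⟫_ℂ) lamInv_mul_lamInv
  rw [norm_eq_sqrt_re_inner (𝕜 := ℂ), this]
  exact (norm_eq_sqrt_re_inner (𝕜 := ℂ) (ContinuousLinearMap.adjoint formEmbed h)).symm

/-- A Schwartz function as an element of the form domain. -/
def schwartzForm (f : 𝓢(R3, ℂ)) : formDomain :=
  ⟨formMap f, Submodule.le_topologicalClosure _ ⟨f, rfl⟩⟩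

lemma formEmbed_schwartzForm (f : 𝓢(R3, ℂ)) :
    formEmbed (schwartzForm f) = SchwartzMap.toLpCLM ℂ ℂ 2 volume f := rfl

lemma denseRange_schwartzForm : DenseRange schwartzForm := by
  intro x
  rw [closure_subtype]
  have h : (x : FormAmbient) ∈ closure (Set.range formMap) := x.2
  rwa [show ((↑) : formDomain → FormAmbient) '' Set.range schwartzForm = Set.range formMap from
    (Set.range_comp _ _).symm]

lemma ker_lamInv : LinearMap.ker (lamInv : L2 →ₗ[ℂ] L2) = ⊥ := by
  rw [LinearMap.ker_eq_bot']
  intro h hh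
  have h1 : ContinuousLinearMap.adjoint formEmbed h = 0 := by
    rw [← norm_eq_zero, ← norm_lamInv_apply, norm_eq_zero]; exact hh
  have h2 : ∀ g : L2, ⟪g, h⟫_ℂ = 0 := by
    have hd : DenseRange (SchwartzMap.toLpCLM ℂ ℂ 2 (volume : Measure R3)) :=
      SchwartzMap.denseRange_toLpCLM ENNReal.ofNat_ne_top
    refine fun g => hd.induction_on (p := fun g => ⟪g, h⟫_ℂ = 0) g
      (isClosed_eq (by fun_prop) (by fun_prop)) fun f => ?_
    rw [← formEmbed_schwartzForm, ← ContinuousLinearMap.adjoint_inner_right, h1, inner_zero_right]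
  exact inner_self_eq_zero.1 (h2 h)

lemma lamInv_injective : Function.Injective lamInv := LinearMap.ker_eq_bot.1 ker_lamInv

lemma denseRange_lamInv : DenseRange lamInv := by
  have : (LinearMap.range (lamInv : L2 →ₗ[ℂ] L2)).topologicalClosure = ⊤ := by
    rw [Submodule.topologicalClosure_eq_top_iff, ContinuousLinearMap.orthogonal_range,
      ContinuousLinearMap.isSelfAdjoint_iff'.1 isSelfAdjoint_lamInv]
    exact ker_lamInv
  exact (Submodule.dense_iff_topologicalClosure_eq_top.2 this)

lemma mem_lam_domain {f : L2} : f ∈ lam.domain ↔ ∃ g, lamInv g = f := by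
  rw [lam, LinearPMap.inverse_domain]
  simp [LinearMap.toPMap]

lemma lam_lamInv (g : L2) (h : lamInv g ∈ lam.domain) : lam ⟨lamInv g, h⟩ = g := by
  refine LinearPMap.inverse_apply_eq (f := (lamInv : L2 →ₗ[ℂ] L2).toPMap ⊤) ?_
    (x := ⟨g, trivial⟩) rfl
  rw [LinearMap.ker_eq_bot']
  intro x hx
  exact Subtype.ext (lamInv_injective (hx.trans (map_zero _).symm))

/-- `Λ ρ Λ = σ` if and only if `ρ = Λ⁻¹ σ Λ⁻¹`. -/
lemma isLamConj_iff {ρ σ : Op} : IsLamConj ρ σ ↔ ρ = lamInv * σ * lamInv := by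
  constructor
  · intro h
    ext1 g
    obtain ⟨h1, h2⟩ := h ⟨lamInv g, mem_lam_domain.2 ⟨g, rfl⟩⟩
    rw [lam_lamInv] at h1
    obtain ⟨w, hw⟩ := mem_lam_domain.1 h1
    have h3 : w = σ (lamInv g) := by
      rw [← h2, ← lam_lamInv w (hw ▸ h1)]
      congr 2
      rw [hw, lam_lamInv]
    rw [← hw, h3]; rfl
  · rintro rfl ⟨f, hf⟩
    obtain ⟨g, rfl⟩ := mem_lam_domain.1 hf
    simp only [lam_lamInv]
    exact ⟨mem_lam_domain.2 ⟨_, rfl⟩, lam_lamInv _ _⟩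

lemma lamInv_conj_injective {σ τ : Op} (h : lamInv * σ * lamInv = lamInv * τ * lamInv) :
    σ = τ := by
  refine ContinuousLinearMap.coeFn_injective
    (denseRange_lamInv.equalizer σ.continuous τ.continuous ?_)
  ext1 g
  exact lamInv_injective (congrArg (fun A : Op => A g) h)

lemma energyNorm_lamInv_conj (σ : Op) : energyNorm (lamInv * σ * lamInv) = traceNorm σ := by
  refine le_antisymm (iInf₂_le σ (isLamConj_iff.2 rfl)) (le_iInf₂ fun τ hτ => ?_)
  rw [lamInv_conj_injective (isLamConj_iff.1 hτ)]

/-- The energy space is the image of the self-adjoint trace class operators under conjugation by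
`Λ⁻¹`: such a conjugate is itself self-adjoint and trace class, so this part of the definition is
automatic. -/
lemma mem_energySpace_iff {ρ : Op} :
    ρ ∈ energySpace ↔ ∃ σ, ρ = lamInv * σ * lamInv ∧ IsSelfAdjointTraceClass σ := by
  constructor
  · rintro ⟨-, σ, h1, h2⟩
    exact ⟨σ, isLamConj_iff.1 h1, h2⟩
  · rintro ⟨σ, rfl, hσ⟩
    refine ⟨⟨?_, ?_⟩, σ, isLamConj_iff.2 rfl, hσ⟩
    · have := hσ.1.conjugate lamInv
      rwa [isSelfAdjoint_lamInv.star_eq] at this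
    · obtain ⟨Q, T, hQ, hT, rfl, -, hQs, hTs⟩ := exists_hilbertSchmidt_factorization hσ.1
      have e : lamInv * (Q * T) * lamInv =
          (lamInv * Q) * ContinuousLinearMap.adjoint (lamInv * T) := by
        rw [← ContinuousLinearMap.star_eq_adjoint, star_mul, hT.star_eq,
          isSelfAdjoint_lamInv.star_eq]
        simp only [mul_assoc]
      rw [e]
      have hfin : ∀ A : Op, hsSq A = traceNorm (Q * T) → ∃ a : ℝ, 0 ≤ a ∧
          hsSq (lamInv * A) ≤ ENNReal.ofReal (a ^ 2) := by
        intro A hA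
        have : hsSq (lamInv * A) < ∞ := (hsSq_comp_left _ _).trans_lt
          (ENNReal.mul_lt_top (by simp) (hA ▸ hσ.2))
        refine ⟨√(hsSq (lamInv * A)).toReal, Real.sqrt_nonneg _, ?_⟩
        rw [Real.sq_sqrt ENNReal.toReal_nonneg, ENNReal.ofReal_toReal this.ne]
      obtain ⟨a, ha, ha'⟩ := hfin Q hQs
      obtain ⟨d, hd, hd'⟩ := hfin T hTs
      exact (traceBound_mul_adjoint ha hd ha' hd').traceNorm_le.trans_lt ENNReal.ofReal_lt_top

/-! ### Multiplication operators -/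

lemma mulOp_apply {φ : R3 → ℂ} (hφ : MemLp φ ∞ volume) (f : L2) :
    mulOp φ f =ᵐ[volume] fun x => φ x * f x := by
  rw [mulOp, dif_pos hφ, ContinuousLinearMap.holderL_apply_apply]
  filter_upwards [(ContinuousLinearMap.mul ℂ ℂ).coeFn_holder (r := 2) hφ.toLp f,
    hφ.coeFn_toLp] with x h1 h2
  rw [h1, h2, ContinuousLinearMap.mul_apply']

lemma memLp_top_of_continuous {φ : R3 → ℂ} (hc : Continuous φ) {a : ℝ} (ha : ∀ x, ‖φ x‖ ≤ a) :
    MemLp φ ∞ volume :=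
  memLp_top_of_bound hc.aestronglyMeasurable a (.of_forall ha)

lemma adjoint_mulOp {φ : R3 → ℂ} (hφ : MemLp φ ∞ volume) :
    ContinuousLinearMap.adjoint (mulOp φ) = mulOp (star φ) := by
  refine ((ContinuousLinearMap.eq_adjoint_iff _ _).2 fun f g => ?_).symm
  rw [MeasureTheory.L2.inner_def, MeasureTheory.L2.inner_def]
  refine integral_congr_ae ?_
  filter_upwards [mulOp_apply hφ g, mulOp_apply hφ.star f] with x h1 h2
  rw [h1, h2]
  simp only [RCLike.inner_apply, Pi.star_apply, map_mul, RCLike.star_def, RCLike.conj_conj]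
  ring

lemma mulOp_sub {φ ψ : R3 → ℂ} (hφ : MemLp φ ∞ volume) (hψ : MemLp ψ ∞ volume) :
    mulOp (φ - ψ) = mulOp φ - mulOp ψ := by
  ext1 f
  refine Lp.ext ?_
  filter_upwards [mulOp_apply hφ f, mulOp_apply hψ f, mulOp_apply (hφ.sub hψ) f,
    Lp.coeFn_sub (mulOp φ f) (mulOp ψ f)] with x h1 h2 h3 h4
  rw [sub_apply, h4, Pi.sub_apply, h1, h2, h3, Pi.sub_apply, sub_mul]

/-! ### Hardy's inequality -/

/-- The regularized inverse square `c² / (1 + c² |y - x|²)`, which increases to `|y - x|⁻²` as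
`c → ∞`. -/
def hardyWeight (c : ℝ) (x y : R3) : ℝ := c ^ 2 * (1 + c ^ 2 * ‖y - x‖ ^ 2)⁻¹

lemma hardyWeight_nonneg (c : ℝ) (x y : R3) : 0 ≤ hardyWeight c x y := by
  unfold hardyWeight; positivity

lemma hardyWeight_le (c : ℝ) (x y : R3) : hardyWeight c x y ≤ c ^ 2 := by
  unfold hardyWeight
  refine mul_le_of_le_one_right (by positivity) (inv_le_one_of_one_le₀ ?_)
  have : 0 ≤ c ^ 2 * ‖y - x‖ ^ 2 := by positivity
  linarith

lemma continuous_hardyWeight (c : ℝ) (x : R3) : Continuous (hardyWeight c x) := by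
  unfold hardyWeight
  refine continuous_const.mul (Continuous.inv₀ (by fun_prop) fun y => by positivity)

lemma hasTemperateGrowth_hardyWeight (c : ℝ) (x : R3) :
    (hardyWeight c x).HasTemperateGrowth := by
  have h1 : (fun y : R3 => (1 + ‖y‖ ^ 2) ^ (-1 : ℝ)).HasTemperateGrowth :=
    Function.hasTemperateGrowth_one_add_norm_sq_rpow R3 (-1)
  have h2 : (fun y : R3 => c • (y - x)).HasTemperateGrowth := by fun_prop
  have h3 := h1.comp h2
  have h4 : (fun y : R3 => c ^ 2 * ((fun y : R3 => (1 + ‖y‖ ^ 2) ^ (-1 : ℝ)) ∘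
      fun y : R3 => c • (y - x)) y).HasTemperateGrowth := by fun_prop
  convert h4 using 2 with y
  simp only [hardyWeight, Function.comp, Real.rpow_neg_one, norm_smul, mul_pow, Real.norm_eq_abs,
    sq_abs]

/-- The derivative of `hardyWeight c x y * (y - x)ᵢ` in the direction `eᵢ`. -/
lemma hasLineDerivAt_hardyField (c : ℝ) (x y : R3) (i : Fin 3) :
    HasLineDerivAt ℝ (fun y : R3 => hardyWeight c x y * (y - x) i)
      (hardyWeight c x y - 2 * hardyWeight c x y ^ 2 * (y - x) i ^ 2) y
      (EuclideanSpace.single i (1 : ℝ)) := by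
  have hn : ∀ t : ℝ, ‖y + t • EuclideanSpace.single i (1 : ℝ) - x‖ ^ 2 =
      ‖y - x‖ ^ 2 + 2 * t * (y - x) i + t ^ 2 := by
    intro t
    rw [add_sub_right_comm, norm_add_sq_real, inner_smul_right, norm_smul,
      EuclideanSpace.inner_single_right]
    simp
    ring
  have hpos : 1 + c ^ 2 * ‖y - x‖ ^ 2 ≠ 0 := by positivity
  unfold HasLineDerivAt
  have hE : (fun t : ℝ => hardyWeight c x (y + t • EuclideanSpace.single i (1 : ℝ)) *
      (y + t • EuclideanSpace.single i (1 : ℝ) - x) i) =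
      fun t : ℝ => c ^ 2 * (1 + c ^ 2 * (‖y - x‖ ^ 2 + 2 * t * (y - x) i + t ^ 2))⁻¹ *
        ((y - x) i + t) := by
    funext t
    rw [hardyWeight, hn]
    congr 1
    simp
    ring
  rw [hE]
  have hd : HasDerivAt (fun t : ℝ => 1 + c ^ 2 * (‖y - x‖ ^ 2 + 2 * t * (y - x) i + t ^ 2))
      (c ^ 2 * (2 * (y - x) i)) 0 := by
    have := ((((hasDerivAt_id (0 : ℝ)).const_mul 2).mul_const ((y - x) i)).const_add
      (‖y - x‖ ^ 2)).add ((hasDerivAt_id (0 : ℝ)).pow 2)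
    exact ((this.const_mul (c ^ 2)).const_add 1).congr_deriv (by simp)
  have hp : 1 + c ^ 2 * (‖y - x‖ ^ 2 + 2 * (0 : ℝ) * (y - x) i + 0 ^ 2) ≠ 0 := by simpa using hpos
  have := ((hd.inv hp).const_mul (c ^ 2)).mul ((hasDerivAt_id (0 : ℝ)).const_add ((y - x) i))
  refine this.congr_deriv ?_
  simp only [hardyWeight, id, Pi.inv_apply, mul_zero, zero_mul, add_zero,
    ne_eq, OfNat.ofNat_ne_zero,
    not_false_eq_true, zero_pow, mul_one]
  field_simp
  ring

/-- Hardy's inequality for Schwartz functions, with a regularized weight. The pointwise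
inequality `w |f|² / 4 ≤ |∇f|² + div (w (y - x) |f|²) / 2` is integrated. -/
lemma hardy_schwartz (c : ℝ) (x : R3) (f : 𝓢(R3, ℂ)) :
    ∫ y, hardyWeight c x y * ‖f y‖ ^ 2 ≤ 4 * ∑ i : Fin 3, ∫ y, ‖coordDeriv i f y‖ ^ 2 := by
  set V : Fin 3 → R3 → ℝ := fun i y => hardyWeight c x y * (y - x) i with hV
  have hVt : ∀ i, (V i).HasTemperateGrowth := by
    intro i
    have h1 : (fun y : R3 => (y - x) i).HasTemperateGrowth := by
      have : (fun y : R3 => EuclideanSpace.proj (𝕜 := ℝ) i (y - x)).HasTemperateGrowth := by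
        fun_prop
      exact this
    exact (hasTemperateGrowth_hardyWeight c x).mul h1
  set G : Fin 3 → 𝓢(R3, ℂ) := fun i => SchwartzMap.smulLeftCLM ℂ (V i) f with hG
  set e : Fin 3 → R3 := fun i => EuclideanSpace.single i (1 : ℝ) with he
  have hGd : ∀ i y, ∂_{e i} (G i) y = V i y • ∂_{e i} f y +
      (hardyWeight c x y - 2 * hardyWeight c x y ^ 2 * (y - x) i ^ 2) • f y := by
    intro i y
    rw [SchwartzMap.lineDerivOp_apply, SchwartzMap.lineDerivOp_apply]
    have h1 := hasLineDerivAt_hardyField c x y i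
    have h2 : HasLineDerivAt ℝ f (lineDeriv ℝ f y (e i)) y (e i) :=
      (f.differentiableAt.lineDifferentiableAt).hasLineDerivAt
    have h3 : HasLineDerivAt ℝ (G i) (V i y • lineDeriv ℝ f y (e i) +
      (hardyWeight c x y - 2 * hardyWeight c x y ^ 2 * (y - x) i ^ 2) • f y) y (e i) := by
      rw [hG, SchwartzMap.smulLeftCLM_apply (hVt i)]
      unfold HasLineDerivAt at h1 h2 ⊢
      refine (h1.smul h2).congr_deriv ?_
      simp [hV, he]
    exact h3.lineDeriv
  have hint : ∀ f g : 𝓢(R3, ℂ), Integrable fun y => inner ℝ (f y) (g y) := fun f g =>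
    (SchwartzMap.bilinLeftCLM (innerSL ℝ) g.hasTemperateGrowth f).integrable
  have hsq : ∀ f : 𝓢(R3, ℂ), Integrable fun y => ‖f y‖ ^ 2 := fun f =>
    (hint f f).congr (.of_forall fun y => real_inner_self_eq_norm_sq _)
  have hibp : ∀ i, ∫ y, (inner ℝ (f y) (∂_{e i} (G i) y) + inner ℝ (∂_{e i} f y) (G i y)) = 0 := by
    intro i
    rw [integral_add (hint _ _) (hint _ _)]
    have : ∫ y, inner ℝ (f y) (∂_{e i} (G i) y) = -∫ y, inner ℝ (∂_{e i} f y) (G i y) :=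
      SchwartzMap.integral_bilinear_lineDerivOp_right_eq_neg_left f (G i) (innerSL ℝ) (e i)
    rw [this]; ring
  have hI : ∀ i, Integrable fun y =>
      ‖coordDeriv i f y‖ ^ 2 + 2⁻¹ * (inner ℝ (f y) (∂_{e i} (G i) y) +
        inner ℝ (∂_{e i} f y) (G i y)) := fun i =>
    (hsq _).add (((hint _ _).add (hint _ _)).const_mul _)
  have hpt : ∀ y, 4⁻¹ * (hardyWeight c x y * ‖f y‖ ^ 2) ≤ ∑ i : Fin 3,
      (‖coordDeriv i f y‖ ^ 2 + 2⁻¹ * (inner ℝ (f y) (∂_{e i} (G i) y) +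
        inner ℝ (∂_{e i} f y) (G i y))) := by
    intro y
    have hGy : ∀ i, G i y = V i y • f y := fun i => SchwartzMap.smulLeftCLM_apply_apply (hVt i) f y
    -- completing the square turns the cross term of `div` into a nonnegative one
    have hterm : ∀ i, ‖coordDeriv i f y‖ ^ 2 + 2⁻¹ * (inner ℝ (f y) (∂_{e i} (G i) y) +
        inner ℝ (∂_{e i} f y) (G i y)) = ‖∂_{e i} f y + (2⁻¹ * V i y) • f y‖ ^ 2 +
          (2⁻¹ * hardyWeight c x y - 4⁻¹ * 5 * hardyWeight c x y ^ 2 * (y - x) i ^ 2) *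
            ‖f y‖ ^ 2 := by
      intro i
      have : coordDeriv i f y = ∂_{e i} f y := rfl
      rw [this, hGd, hGy, norm_add_sq_real, inner_add_right, inner_smul_right, inner_smul_right,
        inner_smul_right, inner_smul_right, real_inner_self_eq_norm_sq, norm_smul, mul_pow,
        real_inner_comm (∂_{e i} f y) (f y), Real.norm_eq_abs, sq_abs, hV]
      ring
    simp only [hterm, Finset.sum_add_distrib, ← Finset.sum_mul]
    have h1 : 0 ≤ ∑ i : Fin 3, ‖∂_{e i} f y + (2⁻¹ * V i y) • f y‖ ^ 2 := by positivity
    have h2 : ∑ i : Fin 3, (2⁻¹ * hardyWeight c x y -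
        4⁻¹ * 5 * hardyWeight c x y ^ 2 * (y - x) i ^ 2) =
        3 * 2⁻¹ * hardyWeight c x y - 4⁻¹ * 5 * (hardyWeight c x y * ‖y - x‖ ^ 2) *
          hardyWeight c x y := by
      rw [Finset.sum_sub_distrib, ← Finset.mul_sum _ (fun i => (y - x) i ^ 2),
        ← EuclideanSpace.real_norm_sq_eq]
      simp only [Finset.sum_const, Finset.card_univ, Fintype.card_fin, nsmul_eq_mul]
      push_cast
      ring
    have h3 : hardyWeight c x y * ‖y - x‖ ^ 2 ≤ 1 := by
      rw [hardyWeight, mul_right_comm, ← div_eq_mul_inv, div_le_one (by positivity)]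
      linarith
    have h4 : 4⁻¹ * hardyWeight c x y ≤ ∑ i : Fin 3, (2⁻¹ * hardyWeight c x y -
        4⁻¹ * 5 * hardyWeight c x y ^ 2 * (y - x) i ^ 2) := by
      rw [h2]
      nlinarith [hardyWeight_nonneg c x y]
    nlinarith [sq_nonneg ‖f y‖]
  have hmain : ∫ y, 4⁻¹ * (hardyWeight c x y * ‖f y‖ ^ 2) ≤
      ∑ i : Fin 3, ∫ y, ‖coordDeriv i f y‖ ^ 2 := by
    calc _ ≤ ∫ y, ∑ i : Fin 3, (‖coordDeriv i f y‖ ^ 2 +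
          2⁻¹ * (inner ℝ (f y) (∂_{e i} (G i) y) + inner ℝ (∂_{e i} f y) (G i y))) := by
          refine integral_mono_of_nonneg (.of_forall fun y => ?_)
            (integrable_finsetSum _ fun i _ => hI i) (.of_forall hpt)
          have := hardyWeight_nonneg c x y
          simp only [Pi.zero_apply]
          positivity
      _ = _ := by
          rw [integral_finsetSum _ fun i _ => hI i]
          refine Finset.sum_congr rfl fun i _ => ?_
          refine (integral_add (hsq _) (((hint _ _).add (hint _ _)).const_mul _)).trans ?_
          rw [add_eq_left, integral_const_mul]
          exact mul_eq_zero_of_right _ (hibp i)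
  rw [integral_const_mul] at hmain
  linarith

lemma enorm_sq_eq_lintegral {E : Type*} [NormedAddCommGroup E] (f : Lp E 2 (volume : Measure R3)) :
    ‖f‖ₑ ^ 2 = ∫⁻ x, ‖f x‖ₑ ^ 2 := by
  have := eLpNorm_nnreal_pow_eq_lintegral (f := f) (p := 2) (μ := volume) (by norm_num)
  rw [Lp.enorm_def]
  simpa using this

lemma norm_toLp_sq (f : 𝓢(R3, ℂ)) : ‖SchwartzMap.toLpCLM ℂ ℂ 2 volume f‖ ^ 2 = ∫ y, ‖f y‖ ^ 2 := by
  have h := SchwartzMap.inner_toL2_toL2_eq f f (volume : Measure R3)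
  have h2 : ∀ y, ⟪f y, f y⟫_ℂ = ((‖f y‖ ^ 2 : ℝ) : ℂ) := fun y => by
    rw [inner_self_eq_norm_sq_to_K]; norm_cast
  simp only [h2, integral_complex_ofReal] at h
  rw [inner_self_eq_norm_sq_to_K] at h
  exact Complex.ofReal_injective (by simpa using h)

lemma norm_schwartzForm_sq (f : 𝓢(R3, ℂ)) :
    ‖schwartzForm f‖ ^ 2 = ∑ j, ‖SchwartzMap.toLpCLM ℂ ℂ 2 volume (formComponent j f)‖ ^ 2 :=
  PiLp.norm_sq_eq_of_L2 _ (formMap f)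

lemma sum_integral_coordDeriv_le (f : 𝓢(R3, ℂ)) :
    ∑ i : Fin 3, ∫ y, ‖coordDeriv i f y‖ ^ 2 ≤ ‖schwartzForm f‖ ^ 2 := by
  rw [norm_schwartzForm_sq, Fintype.sum_sum_type, Fintype.sum_sum_type]
  simp only [norm_toLp_sq]
  have h : ∀ j, 0 ≤ ∫ y, ‖formComponent j f y‖ ^ 2 := fun j =>
    integral_nonneg fun y => sq_nonneg _
  have h1 := Finset.sum_nonneg fun (i : Unit) (_ : i ∈ Finset.univ) => h (.inl i)
  have h2 := Finset.sum_nonneg fun (i : Fin 3) (_ : i ∈ Finset.univ) => h (.inr (.inr i))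
  exact (le_add_of_nonneg_right h2).trans (le_add_of_nonneg_left h1)

/-- The square root of `hardyWeight`, as a multiplier. -/
def hardyMul (c : ℝ) (x y : R3) : ℂ := (√(hardyWeight c x y) : ℝ)

lemma norm_hardyMul_sq (c : ℝ) (x y : R3) : ‖hardyMul c x y‖ ^ 2 = hardyWeight c x y := by
  rw [hardyMul, Complex.norm_real, Real.norm_of_nonneg (Real.sqrt_nonneg _),
    Real.sq_sqrt (hardyWeight_nonneg c x y)]

lemma memLp_hardyMul (c : ℝ) (x : R3) : MemLp (hardyMul c x) ∞ volume := by
  have hc : Continuous (hardyMul c x) :=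
    Complex.continuous_ofReal.comp (Real.continuous_sqrt.comp (continuous_hardyWeight c x))
  refine memLp_top_of_continuous hc (a := |c|) fun y => ?_
  refine abs_le_of_sq_le_sq' ?_ (abs_nonneg c) |>.2
  rw [norm_hardyMul_sq, sq_abs]
  exact hardyWeight_le c x y

lemma norm_hardyMul_formEmbed_le (c : ℝ) (x : R3) (F : formDomain) :
    ‖mulOp (hardyMul c x) (formEmbed F)‖ ≤ 2 * ‖F‖ := by
  refine denseRange_schwartzForm.induction_on
    (p := fun F => ‖mulOp (hardyMul c x) (formEmbed F)‖ ≤ 2 * ‖F‖) F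
    (isClosed_le (by fun_prop) (by fun_prop)) fun f => ?_
  refine abs_le_of_sq_le_sq' ?_ (by positivity) |>.2
  rw [formEmbed_schwartzForm, mul_pow]
  have h1 : ‖mulOp (hardyMul c x) (SchwartzMap.toLpCLM ℂ ℂ 2 volume f)‖ ^ 2 =
      ∫ y, hardyWeight c x y * ‖f y‖ ^ 2 := by
    have hf := f.coeFn_toLp 2 (volume : Measure R3)
    rw [← inner_self_eq_norm_sq (𝕜 := ℂ), MeasureTheory.L2.inner_def, ← integral_re]
    · refine integral_congr_ae ?_
      filter_upwards [mulOp_apply (memLp_hardyMul c x) (SchwartzMap.toLpCLM ℂ ℂ 2 volume f), hf]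
        with y h1 h2
      rw [inner_self_eq_norm_sq, h1, norm_mul, mul_pow, norm_hardyMul_sq,
        SchwartzMap.toLpCLM_apply, h2]
    · exact MeasureTheory.L2.integrable_inner _ _
  rw [h1]
  refine (hardy_schwartz c x f).trans ?_
  have := sum_integral_coordDeriv_le f
  linarith

/-- If a bounded operator `M` satisfies `‖M F‖ ≤ C ‖F‖_q` on the form domain, then
`‖M Λ⁻¹‖ ≤ C`. -/
lemma norm_apply_lamInv_le {M : Op} {C : ℝ} (hC : 0 ≤ C)
    (hM : ∀ F : formDomain, ‖M (formEmbed F)‖ ≤ C * ‖F‖) (g : L2) : ‖M (lamInv g)‖ ≤ C * ‖g‖ := by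
  have h1 : ‖M ∘L formEmbed‖ ≤ C := ContinuousLinearMap.opNorm_le_bound _ hC hM
  have h2 : ‖lamInv * ContinuousLinearMap.adjoint M‖ ≤ C := by
    refine ContinuousLinearMap.opNorm_le_bound _ hC fun h => ?_
    rw [mul_apply_eq_comp, norm_lamInv_apply]
    have h3 : ‖ContinuousLinearMap.adjoint (M ∘L formEmbed)‖ ≤ C := by
      rwa [LinearIsometryEquiv.norm_map]
    rw [ContinuousLinearMap.adjoint_comp] at h3
    exact ContinuousLinearMap.le_of_opNorm_le _ h3 h
  have h4 : ‖M * lamInv‖ ≤ C := by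
    have : M * lamInv = star (lamInv * ContinuousLinearMap.adjoint M) := by
      rw [← ContinuousLinearMap.star_eq_adjoint, star_mul, star_star, isSelfAdjoint_lamInv.star_eq]
    rw [this, ContinuousLinearMap.star_eq_adjoint]
    exact (LinearIsometryEquiv.norm_map _ _).trans_le h2
  exact ContinuousLinearMap.le_of_opNorm_le _ h4 g

/-- The regularized form of `hardy_lamInv`. -/
lemma lintegral_hardyWeight_lamInv_le (c : ℝ) (x : R3) (g : L2) :
    ∫⁻ y, ENNReal.ofReal (hardyWeight c x y) * ‖lamInv g y‖ₑ ^ 2 ≤ 4 * ‖g‖ₑ ^ 2 := by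
  have h := norm_apply_lamInv_le (by norm_num) (norm_hardyMul_formEmbed_le c x) g
  have h2 : ‖mulOp (hardyMul c x) (lamInv g)‖ₑ ≤ 2 * ‖g‖ₑ := by
    rw [← ofReal_norm, ← ofReal_norm]
    refine (ENNReal.ofReal_le_ofReal h).trans ?_
    rw [ENNReal.ofReal_mul (by norm_num)]
    simp
  calc _ = ‖mulOp (hardyMul c x) (lamInv g)‖ₑ ^ 2 := by
        rw [enorm_sq_eq_lintegral]
        refine lintegral_congr_ae ?_
        filter_upwards [mulOp_apply (memLp_hardyMul c x) (lamInv g)] with y hy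
        rw [hy, enorm_mul, mul_pow, ← norm_hardyMul_sq, ENNReal.ofReal_pow (norm_nonneg _),
          ofReal_norm]
    _ ≤ (2 * ‖g‖ₑ) ^ 2 := by gcongr
    _ = _ := by rw [mul_pow]; norm_num

/-- Hardy's inequality on the range of `Λ⁻¹`. -/
lemma hardy_lamInv (x : R3) (g : L2) :
    ∫⁻ y, ENNReal.ofReal ((‖x - y‖ ^ 2)⁻¹) * ‖lamInv g y‖ₑ ^ 2 ≤ 4 * ‖g‖ₑ ^ 2 := by
  have hlim : ∀ y, Tendsto (fun n : ℕ => hardyWeight n x y) atTop (𝓝 ((‖x - y‖ ^ 2)⁻¹)) ∨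
      y = x := by
    intro y
    rcases eq_or_ne y x with h | h
    · exact .inr h
    · left
      have hr : ‖x - y‖ ^ 2 ≠ 0 := by simpa [sub_eq_zero] using h.symm
      have h1 : Tendsto (fun n : ℕ => (((n : ℝ) ^ 2)⁻¹ + ‖x - y‖ ^ 2)⁻¹) atTop
          (𝓝 ((0 + ‖x - y‖ ^ 2)⁻¹)) := by
        refine Tendsto.inv₀ (Tendsto.add_const _ ?_) (by simpa using hr)
        exact (tendsto_inv_atTop_zero.comp
          ((tendsto_pow_atTop two_ne_zero).comp tendsto_natCast_atTop_atTop))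
      rw [zero_add] at h1
      refine h1.congr' ?_
      filter_upwards [eventually_gt_atTop 0] with n hn
      have hn' : (n : ℝ) ≠ 0 := by positivity
      rw [hardyWeight, norm_sub_rev y x]
      field_simp
  calc _ ≤ ∫⁻ y, liminf (fun n : ℕ => ENNReal.ofReal (hardyWeight n x y) * ‖lamInv g y‖ₑ ^ 2)
        atTop := by
        refine lintegral_mono fun y => ?_
        rcases hlim y with h | rfl
        · refine le_of_eq (Tendsto.liminf_eq ?_).symm
          exact ENNReal.Tendsto.mul_const (ENNReal.tendsto_ofReal h) (.inr (by finiteness))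
        · simp
    _ ≤ liminf (fun n : ℕ => ∫⁻ y, ENNReal.ofReal (hardyWeight n x y) * ‖lamInv g y‖ₑ ^ 2)
        atTop := by
        refine lintegral_liminf_le' fun n => ?_
        exact ((continuous_hardyWeight n x).measurable.ennreal_ofReal.aemeasurable).mul
          ((Lp.aestronglyMeasurable _).enorm.pow_const 2)
    _ ≤ _ := by
        refine liminf_le_of_frequently_le' (.of_forall fun n => ?_)
        exact lintegral_hardyWeight_lamInv_le n x g

/-! ### Kernels of products of Hilbert–Schmidt operators -/

/-- `L²` functions on `ℝ³` with values in `L²(ℝ³)`. -/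
abbrev VecL2 : Type := Lp L2 2 (volume : Measure R3)

/-- The tensor `g ⊗ e : x ↦ g x • e`, for a unit vector `e`. -/
def tensorUnit (e : L2) (he : ‖e‖ = 1) : L2 →ₗᵢ[ℂ] VecL2 where
  toLinearMap := ((ContinuousLinearMap.toSpanSingleton ℂ e).compLpL 2 volume).toLinearMap
  norm_map' g := by
    refine congrArg ENNReal.toReal (eLpNorm_congr_norm_ae ?_)
    filter_upwards [(ContinuousLinearMap.toSpanSingleton ℂ e).coeFn_compLp g] with x hx
    change ‖((ContinuousLinearMap.toSpanSingleton ℂ e).compLp g) x‖ = _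
    rw [hx]
    simp [norm_smul, he]

lemma tensorUnit_apply (e : L2) (he : ‖e‖ = 1) (g : L2) :
    tensorUnit e he g =ᵐ[volume] fun x => g x • e := by
  filter_upwards [(ContinuousLinearMap.toSpanSingleton ℂ e).coeFn_compLp g] with x hx
  change ((ContinuousLinearMap.toSpanSingleton ℂ e).compLp g) x = _
  rw [hx]; simp

/-- `U` is the vector-valued function `∑ᵢ A eᵢ ⊗ eᵢ` associated with a Hilbert–Schmidt operator
`A`. -/
def IsVecRep (A : Op) (U : VecL2) : Prop :=
  ∀ i, ∀ᵐ x, ⟪basis L2 i, U x⟫_ℂ = A (basis L2 i) x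

/-- The series `∑ᵢ A eᵢ ⊗ eᵢ` is orthogonal, and its squared norms sum to `‖A‖₂²`. -/
lemma exists_isVecRep {A : Op} (hA : hsSq A < ∞) : ∃ U, IsVecRep A U := by
  classical
  have hn : ∀ i, ‖basis L2 i‖ = 1 := (basis L2).orthonormal.norm_eq_one
  have horth : OrthogonalFamily ℂ (fun _ : basisIndex L2 => L2)
      fun i => tensorUnit (basis L2 i) (hn i) := by
    intro i j hij f g
    rw [MeasureTheory.L2.inner_def]
    refine integral_eq_zero_of_ae ?_
    filter_upwards [tensorUnit_apply _ (hn i) f, tensorUnit_apply _ (hn j) g] with x h1 h2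
    rw [h1, h2, inner_smul_left, inner_smul_right, (basis L2).orthonormal.2 hij]
    simp
  have hsum : Summable fun i => ‖A (basis L2 i)‖ ^ 2 := by
    have := ENNReal.summable_toReal hA.ne
    refine this.congr fun i => ?_
    rw [ENNReal.toReal_pow, toReal_enorm]
  have hs := (horth.summable_iff_norm_sq_summable fun i => A (basis L2 i)).2 hsum
  refine ⟨∑' i, tensorUnit (basis L2 i) (hn i) (A (basis L2 i)), fun i => ?_⟩
  set P : VecL2 →L[ℂ] L2 := (innerSL ℂ (basis L2 i)).compLpL 2 volume with hP
  have hPapp : ∀ u : VecL2, P u =ᵐ[volume] fun x => ⟪basis L2 i, u x⟫_ℂ := fun u =>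
    (innerSL ℂ (basis L2 i)).coeFn_compLp u
  have hPj : ∀ j, P (tensorUnit (basis L2 j) (hn j) (A (basis L2 j))) =
      if j = i then A (basis L2 i) else 0 := by
    intro j
    refine Lp.ext ?_
    split_ifs with h
    · subst h
      filter_upwards [hPapp (tensorUnit (basis L2 j) (hn j) (A (basis L2 j))),
        tensorUnit_apply _ (hn j) (A (basis L2 j))] with x h1 h2
      rw [h1, h2, inner_smul_right, inner_self_eq_norm_sq_to_K, hn]
      simp
    · filter_upwards [hPapp (tensorUnit (basis L2 j) (hn j) (A (basis L2 j))),
        tensorUnit_apply _ (hn j) (A (basis L2 j)), Lp.coeFn_zero ℂ 2 (volume : Measure R3)]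
        with x h1 h2 h3
      rw [h1, h2, inner_smul_right, (basis L2).orthonormal.2 (Ne.symm h), h3]
      simp
  have h1 := hs.hasSum.mapL P
  have h2 : HasSum (fun j => P (tensorUnit (basis L2 j) (hn j) (A (basis L2 j))))
      (A (basis L2 i)) := by
    simp only [hPj]
    exact hasSum_ite_eq i _
  filter_upwards [hPapp (∑' i, tensorUnit (basis L2 i) (hn i) (A (basis L2 i)))] with x hx
  rw [← hx, h1.unique h2]

/-- The vector `∫ conj (g x) U(x) dx`. -/
def conjAverage (g : L2) (U : VecL2) : L2 := ∫ x, star (g x) • U x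

lemma integrable_conj_smul (g : L2) (U : VecL2) : Integrable fun x => star (g x) • U x :=
  memLp_one_iff_integrable.1 ((Lp.memLp U).smul (Lp.memLp g).star)

lemma inner_conjAverage (v : L2) (g : L2) (U : VecL2) :
    ⟪v, conjAverage g U⟫_ℂ = ∫ x, star (g x) * ⟪v, U x⟫_ℂ := by
  rw [conjAverage, ← integral_inner (integrable_conj_smul g U)]
  simp only [inner_smul_right]

lemma IsVecRep.inner_basis_conjAverage {A : Op} {U : VecL2} (h : IsVecRep A U) (g : L2)
    (i : basisIndex L2) :
    ⟪basis L2 i, conjAverage g U⟫_ℂ = ⟪ContinuousLinearMap.adjoint A g, basis L2 i⟫_ℂ := by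
  rw [inner_conjAverage, ContinuousLinearMap.adjoint_inner_left, MeasureTheory.L2.inner_def]
  refine integral_congr_ae ?_
  filter_upwards [h i] with x hx
  rw [hx, RCLike.inner_apply, mul_comm]; rfl

/-- The kernel `(x, y) ↦ ∑ᵢ (A eᵢ)(x) conj ((D eᵢ)(y))` of `A D*`, when `U` and `V` represent
`A` and `D`. -/
def vecKernel (U V : VecL2) (p : R3 × R3) : ℂ := ⟪V p.2, U p.1⟫_ℂ

lemma memLp_vecKernel (U V : VecL2) : MemLp (vecKernel U V) 2 (volume : Measure (R3 × R3)) := by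
  have hm : AEStronglyMeasurable (vecKernel U V) (volume : Measure (R3 × R3)) :=
    ((Lp.stronglyMeasurable V).comp_measurable measurable_snd).aestronglyMeasurable.inner
      ((Lp.stronglyMeasurable U).comp_measurable measurable_fst).aestronglyMeasurable
  have hi : ∀ W : VecL2, Integrable fun x => ‖W x‖ ^ 2 := fun W => (Lp.memLp W).integrable_norm_pow
    two_ne_zero
  rw [memLp_two_iff_integrable_sq_norm hm]
  refine ((hi U).mul_prod (hi V)).mono' (hm.norm.pow 2) (.of_forall fun p => ?_)
  rw [Real.norm_of_nonneg (by positivity), ← mul_pow, mul_comm]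
  gcongr
  exact norm_inner_le_norm _ _

lemma isKernel_vecKernel {A D : Op} {U V : VecL2} (hU : IsVecRep A U) (hV : IsVecRep D V) :
    IsKernel (A * ContinuousLinearMap.adjoint D) (vecKernel U V) := by
  refine ⟨memLp_vecKernel U V, fun f => ?_⟩
  set v := conjAverage f V with hv
  have hw : (innerSL ℂ v).compLp U = (A * ContinuousLinearMap.adjoint D) f := by
    refine ext_inner_left ℂ fun g => ?_
    have h1 : ⟪g, (innerSL ℂ v).compLp U⟫_ℂ = ⟪v, conjAverage g U⟫_ℂ := by
      rw [inner_conjAverage, MeasureTheory.L2.inner_def]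
      refine integral_congr_ae ?_
      filter_upwards [(innerSL ℂ v).coeFn_compLp U] with x hx
      rw [hx, RCLike.inner_apply, mul_comm]; rfl
    rw [h1, mul_apply_eq_comp, ← ContinuousLinearMap.adjoint_inner_left,
      ← (basis L2).tsum_inner_mul_inner, ← (basis L2).tsum_inner_mul_inner]
    refine tsum_congr fun i => ?_
    rw [hU.inner_basis_conjAverage, ← inner_conj_symm, hV.inner_basis_conjAverage,
      inner_conj_symm, mul_comm]
  filter_upwards [(innerSL ℂ v).coeFn_compLp U] with x hx
  rw [← hw, hx, innerSL_apply_apply, ← inner_conj_symm, inner_conjAverage, ← integral_conj]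
  refine integral_congr_ae (.of_forall fun y => ?_)
  simp [vecKernel, mul_comm]

/-! ### Regularized diagonals -/

/-- The change of variables `(x, η) ↦ (x + η/2, x - η/2)`. -/
def shear : (R3 × R3) ≃ₗ[ℝ] (R3 × R3) where
  toFun p := (p.1 + (2⁻¹ : ℝ) • p.2, p.1 - (2⁻¹ : ℝ) • p.2)
  invFun q := ((2⁻¹ : ℝ) • (q.1 + q.2), q.1 - q.2)
  map_add' p q := by ext1 <;> simp <;> module
  map_smul' c p := by ext1 <;> simp <;> module
  left_inv p := by ext1 <;> simp <;> module
  right_inv p := by ext1 <;> simp <;> module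

lemma measurable_shear : Measurable shear :=
  (LinearMap.continuous_of_finiteDimensional shear.toLinearMap).measurable

lemma map_shear : ∃ c : ℝ≥0∞, c ≠ ∞ ∧
    Measure.map shear (volume : Measure (R3 × R3)) = c • (volume : Measure (R3 × R3)) :=
  haveI : (volume : Measure (R3 × R3)).IsAddHaarMeasure :=
    inferInstanceAs (Measure.IsAddHaarMeasure ((volume : Measure R3).prod (volume : Measure R3)))
  ⟨_, ENNReal.ofReal_ne_top, Measure.map_linearMap_addHaar_eq_smul_addHaar
    (μ := (volume : Measure (R3 × R3))) (f := shear.toLinearMap) shear.isUnit_det'.ne_zero⟩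

lemma quasiMeasurePreserving_shear :
    Measure.QuasiMeasurePreserving shear (volume : Measure (R3 × R3)) volume := by
  obtain ⟨c, -, hc⟩ := map_shear
  exact ⟨measurable_shear, hc ▸ Measure.smul_absolutelyContinuous⟩

lemma memLp_comp_shear {k : R3 × R3 → ℂ} (hk : MemLp k 2 volume) :
    MemLp (fun p => k (shear p)) 2 volume := by
  obtain ⟨c, hc, h⟩ := map_shear
  refine MemLp.comp_of_map (f := shear) ?_ measurable_shear.aemeasurable
  rw [h]
  exact hk.smul_measure hc

lemma ae_memLp_slice {k : R3 × R3 → ℂ} (hk : MemLp k 2 volume) :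
    ∀ᵐ x : R3, MemLp (fun y => k (x, y)) 2 volume := by
  have h := ((memLp_two_iff_integrable_sq_norm hk.1).1 hk)
  rw [Measure.volume_eq_prod] at h
  have hm := hk.1
  rw [Measure.volume_eq_prod] at hm
  filter_upwards [h.prod_right_ae, hm.prodMk_left] with x h1 h2
  exact (memLp_two_iff_integrable_sq_norm h2).2 h1

/-- The centred Gaussian density of covariance `ε`. -/
def gauss (ε : ℝ) (η : R3) : ℝ :=
  Real.exp (-‖η‖ ^ 2 / (2 * ε)) / (2 * Real.pi * ε) ^ ((3 : ℝ) / 2)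

lemma mollDiag_eq (k : R3 × R3 → ℂ) (ε : ℝ) (x : R3) :
    mollDiag k ε x = ∫ η, k (shear (x, η)) * (gauss ε η : ℂ) := rfl

lemma continuous_gauss (ε : ℝ) : Continuous (gauss ε) := by unfold gauss; fun_prop

lemma gauss_nonneg {ε : ℝ} (hε : 0 < ε) (η : R3) : 0 ≤ gauss ε η := by
  unfold gauss; positivity

lemma integral_gauss {ε : ℝ} (hε : 0 < ε) : ∫ η, gauss ε η = 1 := by
  have h := GaussianFourier.integral_rexp_neg_mul_sq_norm (V := R3) (b := (2 * ε)⁻¹)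
    (by positivity)
  simp only [gauss, integral_div]
  rw [div_eq_one_iff_eq (by positivity)]
  have e1 : ∀ η : R3, -‖η‖ ^ 2 / (2 * ε) = -(2 * ε)⁻¹ * ‖η‖ ^ 2 := fun η => by ring
  simp only [e1]
  rw [h, div_inv_eq_mul, finrank_euclideanSpace_fin]
  congr 1
  ring

lemma integrable_gauss {ε : ℝ} (hε : 0 < ε) : Integrable (gauss ε) :=
  integrable_of_integral_eq_one (integral_gauss hε)

lemma memLp_gauss {ε : ℝ} (hε : 0 < ε) : MemLp (fun η => (gauss ε η : ℂ)) 2 volume := by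
  have hm : AEStronglyMeasurable (fun η => (gauss ε η : ℂ)) (volume : Measure R3) :=
    (Complex.continuous_ofReal.comp (continuous_gauss ε)).aestronglyMeasurable
  rw [memLp_two_iff_integrable_sq_norm hm]
  refine ((integrable_gauss hε).const_mul (((2 * Real.pi * ε) ^ ((3 : ℝ) / 2))⁻¹)).mono'
    (hm.norm.pow 2) (.of_forall fun η => ?_)
  rw [Real.norm_of_nonneg (by positivity), Complex.norm_real, Real.norm_of_nonneg
    (gauss_nonneg hε η), sq]
  refine mul_le_mul_of_nonneg_right ?_ (gauss_nonneg hε η)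
  rw [gauss, ← one_div]
  gcongr
  refine Real.exp_le_one_iff.2 ?_
  rw [neg_div]
  have : 0 ≤ ‖η‖ ^ 2 / (2 * ε) := by positivity
  linarith

lemma ae_integrable_mollDiag {k : R3 × R3 → ℂ} (hk : MemLp k 2 volume) {ε : ℝ} (hε : 0 < ε) :
    ∀ᵐ x : R3, Integrable fun η => k (shear (x, η)) * (gauss ε η : ℂ) := by
  filter_upwards [ae_memLp_slice (memLp_comp_shear hk)] with x hx
  exact hx.integrable_mul (memLp_gauss hε)

lemma aestronglyMeasurable_mollDiag {k : R3 × R3 → ℂ} (hk : MemLp k 2 volume) (ε : ℝ) :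
    AEStronglyMeasurable (mollDiag k ε) volume := by
  have h : AEStronglyMeasurable (fun p : R3 × R3 => k (shear p) * (gauss ε p.2 : ℂ))
      (volume.prod volume) :=
    (memLp_comp_shear hk).1.mul ((Complex.continuous_ofReal.comp
      ((continuous_gauss ε).comp continuous_snd)).aestronglyMeasurable)
  exact h.integral_prod_right'

lemma mollDiag_congr_ae {k k' : R3 × R3 → ℂ} (h : k =ᵐ[volume] k') (ε : ℝ) :
    mollDiag k ε =ᵐ[volume] mollDiag k' ε := by
  have h1 : ∀ᵐ p : R3 × R3, k (shear p) = k' (shear p) := quasiMeasurePreserving_shear.ae h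
  rw [Measure.volume_eq_prod] at h1
  filter_upwards [Measure.ae_ae_of_ae_prod h1] with x hx
  rw [mollDiag_eq, mollDiag_eq]
  refine integral_congr_ae ?_
  filter_upwards [hx] with η hη
  rw [hη]

lemma mollDiag_sub_ae {k k' : R3 × R3 → ℂ} (hk : MemLp k 2 volume) (hk' : MemLp k' 2 volume)
    {ε : ℝ} (hε : 0 < ε) :
    mollDiag (k - k') ε =ᵐ[volume] fun x => mollDiag k ε x - mollDiag k' ε x := by
  filter_upwards [ae_integrable_mollDiag hk hε, ae_integrable_mollDiag hk' hε] with x h1 h2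
  simp only [mollDiag_eq]
  rw [← integral_sub h1 h2]
  simp only [Pi.sub_apply, sub_mul]

/-! ### Uniqueness and linearity of the density -/

lemma IsKernel.sub {ρ ρ' : Op} {k k' : R3 × R3 → ℂ} (h : IsKernel ρ k) (h' : IsKernel ρ' k') :
    IsKernel (ρ - ρ') (k - k') := by
  refine ⟨h.1.sub h'.1, fun f => ?_⟩
  filter_upwards [h.2 f, h'.2 f, Lp.coeFn_sub (ρ f) (ρ' f), ae_memLp_slice h.1,
    ae_memLp_slice h'.1] with x h1 h2 h3 h4 h5
  rw [sub_apply, h3, Pi.sub_apply, h1, h2]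
  refine (integral_sub (h4.integrable_mul (Lp.memLp f))
    (h5.integrable_mul (Lp.memLp f))).symm.trans ?_
  simp only [Pi.sub_apply, Pi.mul_apply, sub_mul]

/-- The kernel of the zero operator vanishes almost everywhere: almost every slice of it is
orthogonal to a countable dense set. -/
lemma IsKernel.ae_eq_zero {k : R3 × R3 → ℂ} (h : IsKernel 0 k) : k =ᵐ[volume] 0 := by
  have : Fact ((2 : ℝ≥0∞) ≠ ∞) := ⟨ENNReal.ofNat_ne_top⟩
  have h1 : ∀ᵐ x : R3, ∀ n : ℕ, ∫ y, k (x, y) * TopologicalSpace.denseSeq L2 n y = 0 := by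
    rw [ae_all_iff]
    intro n
    filter_upwards [h.2 (TopologicalSpace.denseSeq L2 n), Lp.coeFn_zero ℂ 2 (volume : Measure R3)]
      with x hx h0
    rw [← hx, zero_apply, h0, Pi.zero_apply]
  have h2 : ∀ᵐ x : R3, ∫⁻ y, ‖k (x, y)‖ₑ = 0 := by
    filter_upwards [h1, ae_memLp_slice h.1] with x hx hm
    set g : L2 := hm.star.toLp with hg
    have hgn : ∀ f : L2, ⟪g, f⟫_ℂ = ∫ y, k (x, y) * f y := by
      intro f
      rw [MeasureTheory.L2.inner_def]
      refine integral_congr_ae ?_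
      filter_upwards [hm.star.coeFn_toLp] with y hy
      rw [hg, hy, RCLike.inner_apply]
      simp [mul_comm]
    have hg0 : g = 0 := by
      refine inner_self_eq_zero.1 ((TopologicalSpace.denseRange_denseSeq L2).induction_on
        (p := fun f => ⟪g, f⟫_ℂ = 0) g (isClosed_eq (by fun_prop) (by fun_prop)) fun n => ?_)
      rw [hgn, hx n]
    rw [lintegral_eq_zero_iff' hm.1.enorm]
    filter_upwards [hm.star.coeFn_toLp, Lp.coeFn_zero ℂ 2 (volume : Measure R3)] with y h1 h2
    rw [← hg, hg0, h2] at h1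
    simpa using h1.symm
  have h3 : ∫⁻ p : R3 × R3, ‖k p‖ₑ = 0 := by
    have hm := h.1.1.enorm
    rw [Measure.volume_eq_prod] at hm ⊢
    rw [lintegral_prod _ hm, lintegral_congr_ae h2]
    simp
  rw [lintegral_eq_zero_iff' h.1.1.enorm] at h3
  filter_upwards [h3] with p hp
  simpa using hp

lemma IsDensity.sub {ρ ρ' : Op} {n n' : R3 → ℂ} (h : IsDensity ρ n) (h' : IsDensity ρ' n') :
    IsDensity (ρ - ρ') (n - n') := by
  obtain ⟨hn, k, hk, hlim⟩ := h
  obtain ⟨hn', k', hk', hlim'⟩ := h'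
  refine ⟨hn.sub hn', k - k', hk.sub hk', ?_⟩
  refine tendsto_of_tendsto_of_tendsto_of_le_of_le' tendsto_const_nhds
    (by simpa using hlim.add hlim') (.of_forall fun _ => zero_le) ?_
  filter_upwards [self_mem_nhdsWithin] with ε hε
  calc eLpNorm (fun x => mollDiag (k - k') ε x - (n - n') x) 1 volume
      = eLpNorm ((fun x => mollDiag k ε x - n x) - fun x => mollDiag k' ε x - n' x) 1 volume := by
        refine eLpNorm_congr_ae ?_
        filter_upwards [mollDiag_sub_ae hk.1 hk'.1 hε] with x hx
        rw [hx]; simp only [Pi.sub_apply]; ring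
    _ ≤ _ := eLpNorm_sub_le ((aestronglyMeasurable_mollDiag hk.1 ε).sub hn.1)
        ((aestronglyMeasurable_mollDiag hk'.1 ε).sub hn'.1) le_rfl

lemma IsDensity.ae_eq {ρ : Op} {n n' : R3 → ℂ} (h : IsDensity ρ n) (h' : IsDensity ρ n') :
    n =ᵐ[volume] n' := by
  obtain ⟨hn, k, hk, hlim⟩ := h.sub h'
  rw [sub_self] at hk
  have h0 : ∀ ε, eLpNorm (fun x => mollDiag k ε x - (n - n') x) 1 volume =
      eLpNorm (n - n') 1 volume := by
    intro ε
    rw [← eLpNorm_neg (f := n - n')]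
    refine eLpNorm_congr_ae ?_
    filter_upwards [mollDiag_congr_ae hk.ae_eq_zero ε] with x hx
    rw [hx]
    simp [mollDiag]
  simp only [h0] at hlim
  have h1 := tendsto_nhds_unique tendsto_const_nhds hlim
  rw [eLpNorm_eq_zero_iff hn.1 one_ne_zero] at h1
  filter_upwards [h1] with x hx
  exact sub_eq_zero.1 hx

lemma isDensity_density {ρ : Op} {n : R3 → ℂ} (h : IsDensity ρ n) : IsDensity ρ (density ρ) := by
  have : ∃ n, IsDensity ρ n := ⟨n, h⟩
  rw [density, dif_pos this]
  exact this.choose_spec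

/-! ### Existence of the density -/

/-- The translate `x ↦ U (x + h)`. -/
def translate (U : VecL2) (h : R3) : VecL2 :=
  Lp.compMeasurePreserving (fun x => x + h) (measurePreserving_add_right volume h) U

lemma translate_apply (U : VecL2) (h : R3) : translate U h =ᵐ[volume] fun x => U (x + h) :=
  Lp.coeFn_compMeasurePreserving _ _

lemma norm_translate (U : VecL2) (h : R3) : ‖translate U h‖ = ‖U‖ :=
  Lp.norm_compMeasurePreserving _ _

lemma translate_zero (U : VecL2) : translate U 0 = U := by
  refine Lp.ext ?_
  filter_upwards [translate_apply U 0] with x hx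
  rw [hx, add_zero]

lemma continuous_translate (U : VecL2) : Continuous (translate U) := by
  have h : Continuous fun h : R3 => (⟨fun x => x + h, by fun_prop⟩ : C(R3, R3)) :=
    ContinuousMap.continuous_of_continuous_uncurry _ (by
      change Continuous fun p : R3 × R3 => p.2 + p.1
      fun_prop)
  exact continuous_const.compMeasurePreservingLp h
    (fun h => measurePreserving_add_right volume h) ENNReal.ofNat_ne_top

lemma lintegral_inner_le (U V : VecL2) : ∫⁻ x, ‖⟪V x, U x⟫_ℂ‖ₑ ≤ ‖V‖ₑ * ‖U‖ₑ := by
  have := eLpNorm_le_eLpNorm_mul_eLpNorm_of_nnnorm (p := 2) (q := 2) (r := 1)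
    (Lp.aestronglyMeasurable V) (Lp.aestronglyMeasurable U) (fun v u => ⟪v, u⟫_ℂ) 1
    (.of_forall fun x => by simpa using nnnorm_inner_le_nnnorm (𝕜 := ℂ) (V x) (U x))
  rw [eLpNorm_one_eq_lintegral_enorm] at this
  simpa [Lp.enorm_def] using this

/-- The modulus of continuity `‖V(· - η/2) - V‖ ‖U‖ + ‖V‖ ‖U(· + η/2) - U‖`. -/
def diagModulus (U V : VecL2) (η : R3) : ℝ :=
  ‖translate V (-((2⁻¹ : ℝ) • η)) - V‖ * ‖U‖ + ‖V‖ * ‖translate U ((2⁻¹ : ℝ) • η) - U‖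

lemma continuous_diagModulus (U V : VecL2) : Continuous (diagModulus U V) := by
  have hU := continuous_translate U
  have hV := continuous_translate V
  unfold diagModulus
  fun_prop

lemma diagModulus_zero (U V : VecL2) : diagModulus U V 0 = 0 := by
  simp [diagModulus, translate_zero]

lemma diagModulus_nonneg (U V : VecL2) (η : R3) : 0 ≤ diagModulus U V η := by
  unfold diagModulus
  exact add_nonneg (mul_nonneg (norm_nonneg _) (norm_nonneg _))
    (mul_nonneg (norm_nonneg _) (norm_nonneg _))

lemma diagModulus_le (U V : VecL2) (η : R3) : diagModulus U V η ≤ 4 * (‖U‖ * ‖V‖) := by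
  have h : ∀ (W : VecL2) h, ‖translate W h - W‖ ≤ 2 * ‖W‖ := fun W h => by
    refine (norm_sub_le _ _).trans ?_
    rw [norm_translate]; linarith
  unfold diagModulus
  have h1 := mul_le_mul_of_nonneg_right (h V (-((2⁻¹ : ℝ) • η))) (norm_nonneg U)
  have h2 := mul_le_mul_of_nonneg_left (h U ((2⁻¹ : ℝ) • η)) (norm_nonneg V)
  linarith

lemma lintegral_vecKernel_shear_sub_le (U V : VecL2) (η : R3) :
    ∫⁻ x, ‖vecKernel U V (shear (x, η)) - ⟪V x, U x⟫_ℂ‖ₑ ≤ ENNReal.ofReal (diagModulus U V η) := by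
  set U' := translate U ((2⁻¹ : ℝ) • η)
  set V' := translate V (-((2⁻¹ : ℝ) • η))
  have hm : AEMeasurable (fun x => ‖⟪(V' - V : VecL2) x, U' x⟫_ℂ‖ₑ) (volume : Measure R3) :=
    ((Lp.aestronglyMeasurable (V' - V)).inner (Lp.aestronglyMeasurable U')).enorm
  calc _ ≤ ∫⁻ x, (‖⟪(V' - V : VecL2) x, U' x⟫_ℂ‖ₑ + ‖⟪V x, (U' - U : VecL2) x⟫_ℂ‖ₑ) := by
        refine lintegral_mono_ae ?_
        filter_upwards [translate_apply U ((2⁻¹ : ℝ) • η), translate_apply V (-((2⁻¹ : ℝ) • η)),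
          Lp.coeFn_sub U' U, Lp.coeFn_sub V' V] with x h1 h2 h3 h4
        have : vecKernel U V (shear (x, η)) = ⟪V' x, U' x⟫_ℂ := by
          rw [h1, h2, ← sub_eq_add_neg]; rfl
        rw [this, h3, h4, Pi.sub_apply, Pi.sub_apply, inner_sub_left, inner_sub_right]
        refine le_trans (le_of_eq ?_) (enorm_add_le _ _)
        congr 1; ring
    _ ≤ ‖V' - V‖ₑ * ‖U'‖ₑ + ‖V‖ₑ * ‖U' - U‖ₑ := by
        rw [lintegral_add_left' hm]
        exact add_le_add (lintegral_inner_le _ _) (lintegral_inner_le _ _)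
    _ = _ := by
        rw [diagModulus, ENNReal.ofReal_add (mul_nonneg (norm_nonneg _) (norm_nonneg _))
          (mul_nonneg (norm_nonneg _) (norm_nonneg _)), ENNReal.ofReal_mul (norm_nonneg _),
          ENNReal.ofReal_mul (norm_nonneg _), ofReal_norm, ofReal_norm, ofReal_norm, ofReal_norm,
          ← ofReal_norm U', norm_translate, ofReal_norm]

/-- The Gaussians are an approximate identity as `ε → 0`; substitute `η = √ε ζ`. -/
lemma tendsto_integral_gauss_mul {ψ : R3 → ℝ} (hc : Continuous ψ) (h0 : ψ 0 = 0) {C : ℝ}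
    (hC : ∀ η, ‖ψ η‖ ≤ C) :
    Tendsto (fun ε : ℝ => ∫ η, gauss ε η * ψ η) (𝓝[>] 0) (𝓝 0) := by
  have hscale : ∀ ε : ℝ, 0 < ε → ∫ η, gauss ε η * ψ η = ∫ ζ, gauss 1 ζ * ψ (√ε • ζ) := by
    intro ε hε
    have hs : 0 < √ε := Real.sqrt_pos.2 hε
    have h := Measure.integral_comp_smul (volume : Measure R3) (fun η => gauss ε η * ψ η) (√ε)
    have hpow : ε ^ ((3 : ℝ) / 2) = √ε ^ 3 := by
      rw [Real.sqrt_eq_rpow, ← Real.rpow_natCast, ← Real.rpow_mul hε.le]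
      norm_num
    have hg : ∀ ζ : R3, gauss ε (√ε • ζ) = (√ε ^ 3)⁻¹ * gauss 1 ζ := by
      intro ζ
      have e1 : -‖√ε • ζ‖ ^ 2 / (2 * ε) = -‖ζ‖ ^ 2 / (2 * 1) := by
        rw [norm_smul, mul_pow, Real.norm_of_nonneg hs.le, Real.sq_sqrt hε.le]
        field_simp
      rw [gauss, gauss, e1, Real.mul_rpow (by positivity) hε.le, hpow,
        mul_one (2 * Real.pi), mul_comm (√ε ^ 3)⁻¹,
        ← div_eq_mul_inv, div_div]
    simp only [hg, finrank_euclideanSpace_fin, mul_assoc, integral_const_mul] at h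
    rw [abs_of_nonneg (by positivity), smul_eq_mul] at h
    exact (mul_left_cancel₀ (by positivity) h).symm
  have hlim : Tendsto (fun ε : ℝ => ∫ ζ, gauss 1 ζ * ψ (√ε • ζ)) (𝓝[>] 0)
      (𝓝 (∫ ζ : R3, gauss 1 ζ * ψ 0)) := by
    refine tendsto_integral_filter_of_dominated_convergence (fun ζ => gauss 1 ζ * C)
      (.of_forall fun ε => ?_) (.of_forall fun ε => .of_forall fun ζ => ?_)
      ((integrable_gauss one_pos).mul_const C) (.of_forall fun ζ => ?_)
    · exact ((continuous_gauss 1).mul (hc.comp (by fun_prop))).aestronglyMeasurable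
    · rw [norm_mul, Real.norm_of_nonneg (gauss_nonneg one_pos ζ)]
      exact mul_le_mul_of_nonneg_left (hC _) (gauss_nonneg one_pos ζ)
    · have h1 : Continuous fun ε : ℝ => gauss 1 ζ * ψ (√ε • ζ) := by fun_prop
      have h2 := h1.tendsto 0
      simp only [Real.sqrt_zero, zero_smul] at h2
      exact h2.mono_left nhdsWithin_le_nhds
  simp only [h0, mul_zero, integral_zero] at hlim
  refine hlim.congr' ?_
  filter_upwards [self_mem_nhdsWithin] with ε hε
  exact (hscale ε hε).symm

lemma integrable_inner_vec (U V : VecL2) : Integrable fun x => ⟪V x, U x⟫_ℂ :=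
  MeasureTheory.L2.integrable_inner V U

/-- If `U` and `V` represent `A` and `D`, then `A D*` has the density `x ↦ ⟪V x, U x⟫`. The
regularization error is at most the Gaussian average of the modulus of continuity of translations
in `L²`. -/
lemma isDensity_mul_adjoint {A D : Op} {U V : VecL2} (hU : IsVecRep A U) (hV : IsVecRep D V) :
    IsDensity (A * ContinuousLinearMap.adjoint D) fun x => ⟪V x, U x⟫_ℂ := by
  refine ⟨integrable_inner_vec U V, vecKernel U V, isKernel_vecKernel hU hV, ?_⟩
  have hk := memLp_vecKernel U V
  have hlim := ENNReal.tendsto_ofReal (tendsto_integral_gauss_mul (continuous_diagModulus U V)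
    (diagModulus_zero U V) (C := 4 * (‖U‖ * ‖V‖)) fun η => by
      rw [Real.norm_of_nonneg (diagModulus_nonneg U V η)]; exact diagModulus_le U V η)
  rw [ENNReal.ofReal_zero] at hlim
  refine tendsto_of_tendsto_of_tendsto_of_le_of_le' tendsto_const_nhds hlim
    (.of_forall fun _ => zero_le) ?_
  filter_upwards [self_mem_nhdsWithin] with ε (hε : 0 < ε)
  have hgm : Measurable fun η : R3 => ‖(gauss ε η : ℂ)‖ₑ :=
    (Complex.continuous_ofReal.comp (continuous_gauss ε)).measurable.enorm
  have hm : AEMeasurable (fun p : R3 × R3 =>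
      ‖vecKernel U V (shear p) - ⟪V p.1, U p.1⟫_ℂ‖ₑ * ‖(gauss ε p.2 : ℂ)‖ₑ)
      (volume.prod volume) := by
    refine AEMeasurable.mul (AEStronglyMeasurable.enorm ?_)
      (hgm.comp measurable_snd).aemeasurable
    refine (memLp_comp_shear hk).1.sub ?_
    exact ((Lp.stronglyMeasurable V).comp_measurable measurable_fst).aestronglyMeasurable.inner
      ((Lp.stronglyMeasurable U).comp_measurable measurable_fst).aestronglyMeasurable
  have hgi : Integrable fun η => (gauss ε η : ℂ) := (integrable_gauss hε).ofReal
  have hg1 : ∫ η, (gauss ε η : ℂ) = 1 := by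
    rw [integral_complex_ofReal, integral_gauss hε]; rfl
  rw [eLpNorm_one_eq_lintegral_enorm]
  calc ∫⁻ x, ‖mollDiag (vecKernel U V) ε x - ⟪V x, U x⟫_ℂ‖ₑ
      ≤ ∫⁻ x, ∫⁻ η, ‖vecKernel U V (shear (x, η)) - ⟪V x, U x⟫_ℂ‖ₑ * ‖(gauss ε η : ℂ)‖ₑ := by
        refine lintegral_mono_ae ?_
        filter_upwards [ae_integrable_mollDiag hk hε] with x hx
        have : mollDiag (vecKernel U V) ε x - ⟪V x, U x⟫_ℂ =
            ∫ η, (vecKernel U V (shear (x, η)) - ⟪V x, U x⟫_ℂ) * (gauss ε η : ℂ) := by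
          simp only [sub_mul]
          rw [integral_sub hx (hgi.const_mul _), integral_const_mul, hg1, mul_one, mollDiag_eq]
        rw [this]
        refine (enorm_integral_le_lintegral_enorm _).trans_eq ?_
        simp only [enorm_mul]
    _ = ∫⁻ η, ∫⁻ x, ‖vecKernel U V (shear (x, η)) - ⟪V x, U x⟫_ℂ‖ₑ * ‖(gauss ε η : ℂ)‖ₑ :=
        lintegral_lintegral_swap hm
    _ ≤ ∫⁻ η, ENNReal.ofReal (gauss ε η * diagModulus U V η) := by
        refine lintegral_mono fun η => ?_
        rw [lintegral_mul_const' _ _ enorm_ne_top, mul_comm,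
          ENNReal.ofReal_mul (gauss_nonneg hε η)]
        refine mul_le_mul' (le_of_eq ?_) (lintegral_vecKernel_shear_sub_le U V η)
        rw [← ofReal_norm, Complex.norm_real, Real.norm_of_nonneg (gauss_nonneg hε η)]
    _ = ENNReal.ofReal (∫ η, gauss ε η * diagModulus U V η) := by
        refine (ofReal_integral_eq_lintegral_ofReal ?_ (.of_forall fun η =>
          mul_nonneg (gauss_nonneg hε η) (diagModulus_nonneg U V η))).symm
        refine ((integrable_gauss hε).mul_const (4 * (‖U‖ * ‖V‖))).mono'
          ((continuous_gauss ε).mul (continuous_diagModulus U V)).aestronglyMeasurable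
          (.of_forall fun η => ?_)
        rw [Real.norm_of_nonneg (mul_nonneg (gauss_nonneg hε η) (diagModulus_nonneg U V η))]
        exact mul_le_mul_of_nonneg_left (diagModulus_le U V η) (gauss_nonneg hε η)

/-! ### Bounds for the density and for the Hartree potential -/

lemma norm_lamInv_apply_le (g : L2) : ‖lamInv g‖ ≤ ‖g‖ := by
  have := norm_apply_lamInv_le (M := 1) zero_le_one (fun F => ?_) g
  · simpa using this
  · rw [one_mul]
    exact PiLp.norm_apply_le (F : FormAmbient) (Sum.inl ())

lemma countable_basisIndex : Countable (basisIndex L2) := by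
  have : Fact ((2 : ℝ≥0∞) ≠ ∞) := ⟨ENNReal.ofNat_ne_top⟩
  refine Pairwise.countable_of_isOpen_disjoint (s := fun i => Metric.ball (basis L2 i) 2⁻¹) ?_
    (fun i => Metric.isOpen_ball) fun i => Metric.nonempty_ball.2 (by norm_num)
  intro i j hij
  refine Metric.ball_disjoint_ball ?_
  have h1 : ‖basis L2 i - basis L2 j‖ ^ 2 = 2 := by
    rw [norm_sub_sq (𝕜 := ℂ), (basis L2).orthonormal.2 hij,
      (basis L2).orthonormal.norm_eq_one, (basis L2).orthonormal.norm_eq_one]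
    norm_num
  rw [dist_eq_norm]
  nlinarith [norm_nonneg (basis L2 i - basis L2 j)]

lemma IsVecRep.lintegral_mul_le {A : Op} {U : VecL2} (hU : IsVecRep A U) {w : R3 → ℝ≥0∞}
    (hw : Measurable w) {C : ℝ≥0∞} {Q : Op}
    (h : ∀ i, ∫⁻ y, w y * ‖A (basis L2 i) y‖ₑ ^ 2 ≤ C * ‖Q (basis L2 i)‖ₑ ^ 2) :
    ∫⁻ y, w y * ‖U y‖ₑ ^ 2 ≤ C * hsSq Q := by
  have := countable_basisIndex
  calc ∫⁻ y, w y * ‖U y‖ₑ ^ 2 = ∫⁻ y, ∑' i, w y * ‖A (basis L2 i) y‖ₑ ^ 2 := by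
        refine lintegral_congr_ae ?_
        filter_upwards [ae_all_iff.2 hU] with y hy
        rw [← tsum_enorm_inner_sq, ENNReal.tsum_mul_left]
        simp only [hy]
    _ = ∑' i, ∫⁻ y, w y * ‖A (basis L2 i) y‖ₑ ^ 2 :=
        lintegral_tsum fun i => hw.aemeasurable.mul
          ((Lp.aestronglyMeasurable _).enorm.pow_const 2)
    _ ≤ _ := by
        rw [hsSq, ← ENNReal.tsum_mul_left]
        exact ENNReal.tsum_le_tsum h

lemma enorm_inner_le_half (u v : L2) : ‖⟪v, u⟫_ℂ‖ₑ ≤ 2⁻¹ * (‖u‖ₑ ^ 2 + ‖v‖ₑ ^ 2) := by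
  have h : ‖⟪v, u⟫_ℂ‖ ≤ 2⁻¹ * (‖u‖ ^ 2 + ‖v‖ ^ 2) := by
    have := norm_inner_le_norm (𝕜 := ℂ) v u
    nlinarith [sq_nonneg (‖u‖ - ‖v‖)]
  have h2 := ENNReal.ofReal_le_ofReal h
  rw [ofReal_norm, ENNReal.ofReal_mul (by norm_num), ENNReal.ofReal_add (by positivity)
    (by positivity), ENNReal.ofReal_pow (norm_nonneg _), ENNReal.ofReal_pow (norm_nonneg _),
    ofReal_norm, ofReal_norm, ENNReal.ofReal_inv_of_pos two_pos] at h2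
  simpa using h2

/-- The particle density of `Λ⁻¹ σ Λ⁻¹` is real, and it satisfies Hardy's inequality with the
trace norm of `σ`. -/
lemma exists_isDensity_lamInv_conj {σ : Op} (hσ : IsSelfAdjointTraceClass σ) :
    ∃ n, IsDensity (lamInv * σ * lamInv) n ∧ (∀ᵐ x, star (n x) = n x) ∧
      ∫⁻ x, ‖n x‖ₑ ≤ traceNorm σ ∧
      ∀ x, ∫⁻ y, ENNReal.ofReal ((‖x - y‖ ^ 2)⁻¹) * ‖n y‖ₑ ≤ 4 * traceNorm σ := by
  obtain ⟨Q, T, hQ, hT, hQT, hTQ, hQs, hTs⟩ := exists_hilbertSchmidt_factorization hσ.1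
  have hfin : ∀ R : Op, hsSq R = traceNorm σ → hsSq (lamInv * R) < ∞ := fun R hR =>
    (hsSq_comp_left _ _).trans_lt (ENNReal.mul_lt_top (by simp) (hR ▸ hσ.2))
  obtain ⟨U, hU⟩ := exists_isVecRep (hfin Q hQs)
  obtain ⟨V, hV⟩ := exists_isVecRep (hfin T hTs)
  have hadj : ∀ R P : Op, IsSelfAdjoint P →
      (lamInv * R) * ContinuousLinearMap.adjoint (lamInv * P) = lamInv * (R * P) * lamInv := by
    intro R P hP
    rw [← ContinuousLinearMap.star_eq_adjoint, star_mul, hP.star_eq,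
      isSelfAdjoint_lamInv.star_eq]
    simp only [mul_assoc]
  have h1 := isDensity_mul_adjoint hU hV
  have h2 := isDensity_mul_adjoint hV hU
  rw [hadj Q T hT, hQT] at h1
  rw [hadj T Q hQ, hTQ] at h2
  have hbound : ∀ (w : R3 → ℝ≥0∞) (_ : Measurable w) (C : ℝ≥0∞)
      (_ : ∀ g : L2, ∫⁻ y, w y * ‖lamInv g y‖ₑ ^ 2 ≤ C * ‖g‖ₑ ^ 2),
      ∫⁻ y, w y * ‖⟪V y, U y⟫_ℂ‖ₑ ≤ C * traceNorm σ := by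
    intro w hw C hC
    have hUw := hU.lintegral_mul_le hw (C := C) (Q := Q) fun i => hC _
    have hVw := hV.lintegral_mul_le hw (C := C) (Q := T) fun i => hC _
    calc _ ≤ ∫⁻ y, 2⁻¹ * (w y * ‖U y‖ₑ ^ 2 + w y * ‖V y‖ₑ ^ 2) := by
          refine lintegral_mono fun y => ?_
          rw [← mul_add, mul_left_comm]
          exact mul_le_mul' le_rfl (enorm_inner_le_half _ _)
      _ ≤ 2⁻¹ * (C * hsSq Q + C * hsSq T) := by
          have hm : AEMeasurable (fun y => w y * ‖U y‖ₑ ^ 2) (volume : Measure R3) :=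
            hw.aemeasurable.mul ((Lp.aestronglyMeasurable U).enorm.pow_const 2)
          rw [lintegral_const_mul' _ _ (by simp), lintegral_add_left' hm]
          gcongr
      _ = C * traceNorm σ := by
          rw [hQs, hTs, ← two_mul, ← mul_assoc, ENNReal.inv_mul_cancel (by simp) (by simp), one_mul]
  refine ⟨_, h1, ?_, ?_, fun x => ?_⟩
  · filter_upwards [h1.ae_eq h2] with x hx
    rw [RCLike.star_def, inner_conj_symm, hx]
  · have := hbound (fun _ => 1) measurable_const 1 fun g => by
      simp only [one_mul, ← enorm_sq_eq_lintegral]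
      rw [← ofReal_norm, ← ofReal_norm]
      gcongr
      exact norm_lamInv_apply_le g
    simpa using this
  · exact hbound _ (by fun_prop) 4 fun g => hardy_lamInv x g

/-- The Coulomb potential `(4π)⁻¹ ∫ n(y) / |x - y| dy`. -/
def coulomb (n : R3 → ℂ) (x : R3) : ℂ :=
  (4 * Real.pi : ℂ)⁻¹ * ∫ y : R3, n y / ((‖x - y‖ : ℝ) : ℂ)

lemma coulomb_congr_ae {n n' : R3 → ℂ} (h : n =ᵐ[volume] n') : coulomb n = coulomb n' := by
  funext x
  rw [coulomb, coulomb]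
  congr 1
  refine integral_congr_ae ?_
  filter_upwards [h] with y hy
  rw [hy]

/-- The bounds on `n` that control its Coulomb potential:
`‖n‖₁ ≤ N` and `∫ |n(y)| / |x - y|² dy ≤ 4 N` for all `x`. -/
structure HardyBound (n : R3 → ℂ) (N : ℝ) : Prop where
  nonneg : 0 ≤ N
  integrable : Integrable n
  integral_le : ∫ y, ‖n y‖ ≤ N
  integrable_weight : ∀ x : R3, Integrable fun y => (‖x - y‖ ^ 2)⁻¹ * ‖n y‖
  integral_weight_le : ∀ x : R3, ∫ y, (‖x - y‖ ^ 2)⁻¹ * ‖n y‖ ≤ 4 * N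

lemma HardyBound.of_lintegral {n : R3 → ℂ} {N : ℝ≥0∞} (hN : N ≠ ∞)
    (hm : AEStronglyMeasurable n volume) (h1 : ∫⁻ x, ‖n x‖ₑ ≤ N)
    (h2 : ∀ x : R3, ∫⁻ y, ENNReal.ofReal ((‖x - y‖ ^ 2)⁻¹) * ‖n y‖ₑ ≤ 4 * N) :
    HardyBound n N.toReal := by
  have hwm : ∀ x : R3, AEStronglyMeasurable (fun y => (‖x - y‖ ^ 2)⁻¹ * ‖n y‖) volume := fun x =>
    (by fun_prop : Measurable fun y : R3 => (‖x - y‖ ^ 2)⁻¹).aestronglyMeasurable.mul hm.norm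
  have hwe : ∀ x y : R3, ‖(‖x - y‖ ^ 2)⁻¹ * ‖n y‖‖ₑ =
      ENNReal.ofReal ((‖x - y‖ ^ 2)⁻¹) * ‖n y‖ₑ := fun x y => by
    rw [enorm_mul, enorm_norm, Real.enorm_of_nonneg (by positivity)]
  refine ⟨ENNReal.toReal_nonneg, ⟨hm, h1.trans_lt hN.lt_top⟩, ?_, fun x => ⟨hwm x, ?_⟩, fun x => ?_⟩
  · rw [integral_norm_eq_lintegral_enorm hm]
    exact ENNReal.toReal_mono hN h1
  · refine lt_of_le_of_lt ?_ (ENNReal.mul_lt_top (by simp : (4 : ℝ≥0∞) < ∞) hN.lt_top)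
    simpa only [hwe] using h2 x
  · have h3 := integral_norm_eq_lintegral_enorm (hwm x)
    have h4 : ∀ y : R3, ‖(‖x - y‖ ^ 2)⁻¹ * ‖n y‖‖ = (‖x - y‖ ^ 2)⁻¹ * ‖n y‖ := fun y =>
      Real.norm_of_nonneg (by positivity)
    simp only [h4, hwe] at h3
    rw [h3]
    refine (ENNReal.toReal_mono (ENNReal.mul_ne_top (by simp) hN) (h2 x)).trans_eq ?_
    simp

section Coulomb

variable {n : R3 → ℂ} {N : ℝ}

lemma HardyBound.integrable_div (h : HardyBound n N) (x : R3) :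
    Integrable fun y : R3 => n y / ((‖x - y‖ : ℝ) : ℂ) := by
  refine ((h.integrable.norm.add (h.integrable_weight x)).const_mul 2⁻¹).mono' ?_
    (.of_forall fun y => ?_)
  · exact h.integrable.1.div₀
      (by fun_prop : Measurable fun y : R3 => ((‖x - y‖ : ℝ) : ℂ)).aestronglyMeasurable
  · rw [norm_div, Complex.norm_real, norm_norm, div_eq_mul_inv]
    simp only [Pi.add_apply, ← inv_pow]
    nlinarith [norm_nonneg (n y), mul_nonneg (norm_nonneg (n y)) (sq_nonneg (‖x - y‖⁻¹ - 1))]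

lemma norm_coulomb_factor : ‖(4 * Real.pi : ℂ)⁻¹‖ = (4 * Real.pi)⁻¹ := by
  rw [norm_inv, norm_mul, Complex.norm_real, Real.norm_of_nonneg Real.pi_pos.le]
  norm_num

lemma HardyBound.norm_coulomb_le (h : HardyBound n N) (x : R3) : ‖coulomb n x‖ ≤ N := by
  have h1 : ‖∫ y : R3, n y / ((‖x - y‖ : ℝ) : ℂ)‖ ≤ 2⁻¹ * (N + 4 * N) := by
    calc _ ≤ ∫ y : R3, 2⁻¹ * (‖n y‖ + (‖x - y‖ ^ 2)⁻¹ * ‖n y‖) := by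
          refine norm_integral_le_of_norm_le
            ((h.integrable.norm.add (h.integrable_weight x)).const_mul 2⁻¹) (.of_forall fun y => ?_)
          rw [norm_div, Complex.norm_real, norm_norm, div_eq_mul_inv]
          simp only [← inv_pow]
          nlinarith [norm_nonneg (n y), mul_nonneg (norm_nonneg (n y)) (sq_nonneg (‖x - y‖⁻¹ - 1))]
      _ ≤ _ := by
          rw [integral_const_mul, integral_add h.integrable.norm (h.integrable_weight x)]
          have := h.integral_le
          have := h.integral_weight_le x
          linarith
  rw [coulomb, norm_mul, norm_coulomb_factor, inv_mul_le_iff₀ (by positivity)]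
  nlinarith [Real.pi_gt_three, h.nonneg]

lemma HardyBound.norm_coulomb_sub_le (h : HardyBound n N) (x x' : R3) :
    ‖coulomb n x - coulomb n x'‖ ≤ N * ‖x - x'‖ := by
  have h1 : ‖(∫ y : R3, n y / ((‖x - y‖ : ℝ) : ℂ)) - ∫ y : R3, n y / ((‖x' - y‖ : ℝ) : ℂ)‖ ≤
      ‖x - x'‖ * (2⁻¹ * (4 * N + 4 * N)) := by
    rw [← integral_sub (h.integrable_div x) (h.integrable_div x')]
    calc _ ≤ ∫ y : R3, ‖x - x'‖ * (2⁻¹ * ((‖x - y‖ ^ 2)⁻¹ * ‖n y‖ + (‖x' - y‖ ^ 2)⁻¹ * ‖n y‖)) := by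
          refine norm_integral_le_of_norm_le
            ((((h.integrable_weight x).add (h.integrable_weight x')).const_mul 2⁻¹).const_mul _) ?_
          filter_upwards [Measure.ae_ne volume x, Measure.ae_ne volume x'] with y hy hy'
          have hr : 0 < ‖x - y‖ := norm_pos_iff.2 (sub_ne_zero.2 hy.symm)
          have hr' : 0 < ‖x' - y‖ := norm_pos_iff.2 (sub_ne_zero.2 hy'.symm)
          have e1 : n y / ((‖x - y‖ : ℝ) : ℂ) - n y / ((‖x' - y‖ : ℝ) : ℂ) =
              n y * (((‖x' - y‖ - ‖x - y‖) * (‖x - y‖⁻¹ * ‖x' - y‖⁻¹) : ℝ) : ℂ) := by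
            have : ((‖x - y‖ : ℝ) : ℂ) ≠ 0 := by exact_mod_cast hr.ne'
            have : ((‖x' - y‖ : ℝ) : ℂ) ≠ 0 := by exact_mod_cast hr'.ne'
            push_cast
            field_simp
          have e2 : |‖x' - y‖ - ‖x - y‖| ≤ ‖x - x'‖ := by
            refine (abs_norm_sub_norm_le _ _).trans_eq ?_
            rw [sub_sub_sub_cancel_right, norm_sub_rev]
          rw [e1, norm_mul, Complex.norm_real, norm_mul, Real.norm_eq_abs,
            Real.norm_of_nonneg (by positivity)]
          have e3 : ‖x - y‖⁻¹ * ‖x' - y‖⁻¹ ≤ 2⁻¹ * ((‖x - y‖ ^ 2)⁻¹ + (‖x' - y‖ ^ 2)⁻¹) := by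
            rw [← inv_pow, ← inv_pow]
            nlinarith [sq_nonneg (‖x - y‖⁻¹ - ‖x' - y‖⁻¹)]
          calc _ ≤ ‖n y‖ * (‖x - x'‖ * (2⁻¹ * ((‖x - y‖ ^ 2)⁻¹ + (‖x' - y‖ ^ 2)⁻¹))) := by
                gcongr
            _ = _ := by ring
      _ ≤ _ := by
          rw [integral_const_mul, integral_const_mul,
            integral_add (h.integrable_weight x) (h.integrable_weight x')]
          have := h.integral_weight_le x
          have := h.integral_weight_le x'
          gcongr
  rw [coulomb, coulomb, ← mul_sub, norm_mul, norm_coulomb_factor,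
    inv_mul_le_iff₀ (by positivity)]
  have := mul_nonneg h.nonneg (norm_nonneg (x - x'))
  nlinarith [Real.pi_gt_three]

end Coulomb

/-! ### Bounded Lipschitz functions act on the form domain -/

/-- A cutoff function that is `1` on the ball of radius `k`, vanishes outside the ball of radius
`k + 1`, and is `1`-Lipschitz. -/
def cutoff (k : ℕ) (x : R3) : ℝ := max 0 (min 1 (k + 1 - ‖x‖))

lemma cutoff_nonneg (k : ℕ) (x : R3) : 0 ≤ cutoff k x := le_max_left _ _

lemma cutoff_le_one (k : ℕ) (x : R3) : cutoff k x ≤ 1 :=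
  max_le zero_le_one (min_le_left _ _)

lemma cutoff_eq_one {k : ℕ} {x : R3} (h : ‖x‖ ≤ k) : cutoff k x = 1 := by
  rw [cutoff, min_eq_left (by linarith), max_eq_right zero_le_one]

lemma abs_cutoff_sub_le (k : ℕ) (x x' : R3) : |cutoff k x - cutoff k x'| ≤ ‖x - x'‖ := by
  refine (abs_max_sub_max_le_max _ _ _ _).trans (max_le (by simp) ?_)
  refine (abs_min_sub_min_le_max _ _ _ _).trans (max_le (by simp) ?_)
  rw [sub_sub_sub_cancel_left]
  rw [norm_sub_rev]
  exact abs_norm_sub_norm_le _ _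

lemma hasCompactSupport_cutoff (k : ℕ) : HasCompactSupport (cutoff k) := by
  refine HasCompactSupport.intro (isCompact_closedBall 0 ((k : ℝ) + 1)) fun x hx => ?_
  rw [mem_closedBall_zero_iff, not_le] at hx
  exact max_eq_left ((min_le_right _ _).trans (by linarith))

lemma continuous_of_lipschitz {φ : R3 → ℂ} {C : ℝ} (h : ∀ x x', ‖φ x - φ x'‖ ≤ C * ‖x - x'‖) :
    Continuous φ :=
  (LipschitzWith.of_dist_le_mul (K := C.toNNReal) fun x x' => by
    rw [dist_eq_norm, dist_eq_norm]
    exact (h x x').trans (mul_le_mul_of_nonneg_right (Real.le_coe_toNNReal C)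
      (norm_nonneg _))).continuous

/-- A bounded Lipschitz function is a pointwise limit of Schwartz functions with uniform bounds:
cut off, and convolve with a bump function. -/
lemma exists_schwartz_approx {φ : R3 → ℂ} {N : ℝ} (hN : 0 ≤ N) (hb : ∀ x, ‖φ x‖ ≤ N)
    (hl : ∀ x x', ‖φ x - φ x'‖ ≤ N * ‖x - x'‖) :
    ∃ m : ℕ → 𝓢(R3, ℂ), (∀ k x, ‖m k x‖ ≤ N) ∧
      (∀ k i x, ‖coordDeriv i (m k) x‖ ≤ 2 * N) ∧
      ∀ x, Tendsto (fun k => m k x) atTop (𝓝 (φ x)) := by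
  set ψ : ℕ → R3 → ℂ := fun k x => cutoff k x • φ x with hψ
  have hψb : ∀ k x, ‖ψ k x‖ ≤ N := fun k x => by
    rw [norm_smul, Real.norm_of_nonneg (cutoff_nonneg k x)]
    exact (mul_le_of_le_one_left (norm_nonneg _) (cutoff_le_one k x)).trans (hb x)
  have hψl : ∀ k x x', ‖ψ k x - ψ k x'‖ ≤ 2 * N * ‖x - x'‖ := fun k x x' => by
    have e : ψ k x - ψ k x' = (cutoff k x - cutoff k x') • φ x +
        cutoff k x' • (φ x - φ x') := by simp only [hψ]; module
    rw [e]
    refine (norm_add_le _ _).trans ?_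
    rw [norm_smul, norm_smul, Real.norm_of_nonneg (cutoff_nonneg k x')]
    have h1 := mul_le_mul (abs_cutoff_sub_le k x x') (hb x) (norm_nonneg _) (norm_nonneg _)
    have h2 := mul_le_of_le_one_left (norm_nonneg (φ x - φ x')) (cutoff_le_one k x')
    have h3 := hl x x'
    rw [Real.norm_eq_abs]
    linarith
  have hψc : ∀ k, Continuous (ψ k) := fun k => continuous_of_lipschitz (hψl k)
  have hψs : ∀ k, HasCompactSupport (ψ k) := fun k => (hasCompactSupport_cutoff k).smul_right
  set b : ℕ → ContDiffBump (0 : R3) := fun k =>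
    ⟨((k : ℝ) + 1)⁻¹ / 2, ((k : ℝ) + 1)⁻¹, by positivity, half_lt_self (by positivity)⟩ with hbdef
  set g : ℕ → R3 → ℂ := fun k =>
    convolution ((b k).normed volume) (ψ k) (ContinuousLinearMap.lsmul ℝ ℝ) volume with hg
  have hgapp : ∀ k x, g k x = ∫ t, (b k).normed volume t • ψ k (x - t) := fun k x => rfl
  have hint : ∀ k x, Integrable fun t => (b k).normed volume t • ψ k (x - t) := fun k x =>
    ((b k).continuous_normed.smul ((hψc k).comp (by fun_prop))).integrable_of_hasCompactSupport
      (b k).hasCompactSupport_normed.smul_right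
  -- averages against the bump function obey the bounds of the averaged function
  have havg : ∀ k (G : R3 → ℂ) (C : ℝ), (∀ t, ‖G t‖ ≤ C) →
      ‖∫ t, (b k).normed volume t • G t‖ ≤ C := fun k G C hG => by
    have h1 : ∫ t, C * (b k).normed volume t = C := by
      rw [integral_const_mul, (b k).integral_normed, mul_one]
    refine (norm_integral_le_of_norm_le ((b k).integrable_normed.const_mul C)
      (.of_forall fun t => ?_)).trans_eq h1
    rw [norm_smul, Real.norm_of_nonneg ((b k).nonneg_normed t), mul_comm]
    exact mul_le_mul_of_nonneg_right (hG t) ((b k).nonneg_normed t)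
  have hgl : ∀ k x x', ‖g k x - g k x'‖ ≤ 2 * N * ‖x - x'‖ := fun k x x' => by
    rw [hgapp, hgapp, ← integral_sub (hint k x) (hint k x')]
    simp only [← smul_sub]
    refine havg k _ _ fun t => ?_
    simpa using hψl k (x - t) (x' - t)
  have hgs : ∀ k, HasCompactSupport (g k) := fun k =>
    (b k).hasCompactSupport_normed.convolution _ (hψs k)
  have hgd : ∀ k, ContDiff ℝ (⊤ : ℕ∞) (g k) := fun k =>
    (b k).hasCompactSupport_normed.contDiff_convolution_left _ (b k).contDiff_normed
      (hψc k).locallyIntegrable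
  refine ⟨fun k => (hgs k).toSchwartzMap (hgd k), fun k x => ?_, fun k i x => ?_, fun x => ?_⟩
  · exact havg k _ _ fun t => hψb k _
  · have hL : LipschitzWith (2 * N).toNNReal (g k) := LipschitzWith.of_dist_le_mul fun x x' => by
      rw [dist_eq_norm, dist_eq_norm, Real.coe_toNNReal _ (by positivity)]
      exact hgl k x x'
    change ‖(∂_{EuclideanSpace.single i (1 : ℝ)} ((hgs k).toSchwartzMap (hgd k))) x‖ ≤ 2 * N
    rw [SchwartzMap.lineDerivOp_apply_eq_fderiv]
    have h1 := norm_fderiv_le_of_lipschitz ℝ hL (x₀ := x)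
    rw [Real.coe_toNNReal _ (by positivity)] at h1
    refine (ContinuousLinearMap.le_of_opNorm_le _ h1 _).trans_eq ?_
    simp
  · rw [tendsto_iff_norm_sub_tendsto_zero]
    have h0 : Tendsto (fun k : ℕ => 2 * N * ((k : ℝ) + 1)⁻¹) atTop (𝓝 0) := by
      have := (tendsto_one_div_add_atTop_nhds_zero_nat (𝕜 := ℝ)).const_mul (2 * N)
      simpa using this
    refine squeeze_zero' (.of_forall fun _ => norm_nonneg _) ?_ h0
    filter_upwards [eventually_ge_atTop ⌈‖x‖⌉₊] with k hk
    have hx : ψ k x = φ x := by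
      simp only [hψ]
      rw [cutoff_eq_one ((Nat.le_ceil _).trans (by exact_mod_cast hk)), one_smul]
    have := (b k).dist_normed_convolution_le (μ := volume) (x₀ := x)
      (ε := 2 * N * ((k : ℝ) + 1)⁻¹) (hψc k).aestronglyMeasurable fun y hy => by
        rw [dist_eq_norm]
        refine (hψl k y x).trans ?_
        have : ‖y - x‖ < ((k : ℝ) + 1)⁻¹ := by simpa [dist_eq_norm] using hy
        exact mul_le_mul_of_nonneg_left this.le (by positivity)
    rw [hx, dist_eq_norm] at this
    exact this

lemma norm_toLp_le {f g : 𝓢(R3, ℂ)} {a : ℝ} (h : ∀ x, ‖g x‖ ≤ a * ‖f x‖) :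
    ‖SchwartzMap.toLpCLM ℂ ℂ 2 (volume : Measure R3) g‖ ≤
      a * ‖SchwartzMap.toLpCLM ℂ ℂ 2 (volume : Measure R3) f‖ := by
  refine Lp.norm_le_mul_norm_of_ae_le_mul ?_
  filter_upwards [f.coeFn_toLp 2 (volume : Measure R3), g.coeFn_toLp 2 (volume : Measure R3)]
    with x h1 h2
  rw [SchwartzMap.toLpCLM_apply, SchwartzMap.toLpCLM_apply, h1, h2]
  exact h x

/-- The product of two Schwartz functions. -/
def schwartzMul (m f : 𝓢(R3, ℂ)) : 𝓢(R3, ℂ) := SchwartzMap.smulLeftCLM ℂ m f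

lemma schwartzMul_apply (m f : 𝓢(R3, ℂ)) (x : R3) : schwartzMul m f x = m x * f x :=
  SchwartzMap.smulLeftCLM_apply_apply m.hasTemperateGrowth f x

lemma coordDeriv_schwartzMul (m f : 𝓢(R3, ℂ)) (i : Fin 3) :
    coordDeriv i (schwartzMul m f) =
      schwartzMul m (coordDeriv i f) + schwartzMul (coordDeriv i m) f := by
  ext x
  rw [add_apply, schwartzMul_apply, schwartzMul_apply]
  have e : ∀ g : 𝓢(R3, ℂ), coordDeriv i g = ∂_{EuclideanSpace.single i (1 : ℝ)} g := fun g => rfl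
  rw [e, e, e]
  rw [SchwartzMap.lineDerivOp_apply_eq_fderiv, SchwartzMap.lineDerivOp_apply_eq_fderiv,
    SchwartzMap.lineDerivOp_apply_eq_fderiv]
  have h : (schwartzMul m f : R3 → ℂ) = fun x => m x * f x := funext (schwartzMul_apply m f)
  rw [h, fderiv_fun_mul m.differentiableAt f.differentiableAt]
  simp [mul_comm]

/-- Each of the seven components of `m f` is at most `N` times that of `f` plus `2 N ‖f‖`, and
`2 N² + 7 · 8 N² ≤ (8 N)²`. -/
lemma norm_schwartzForm_schwartzMul_le {m : 𝓢(R3, ℂ)} {N : ℝ} (hN : 0 ≤ N)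
    (hb : ∀ x, ‖m x‖ ≤ N) (hd : ∀ i x, ‖coordDeriv i m x‖ ≤ 2 * N) (f : 𝓢(R3, ℂ)) :
    ‖schwartzForm (schwartzMul m f)‖ ≤ 8 * N * ‖schwartzForm f‖ := by
  set T := SchwartzMap.toLpCLM ℂ ℂ 2 (volume : Measure R3) with hT
  have hmul : ∀ g : 𝓢(R3, ℂ), ‖T (schwartzMul m g)‖ ≤ N * ‖T g‖ := fun g =>
    norm_toLp_le fun x => by
      rw [schwartzMul_apply, norm_mul]
      exact mul_le_mul_of_nonneg_right (hb x) (norm_nonneg _)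
  have hcomp : ∀ j, ‖T (formComponent j (schwartzMul m f))‖ ≤
      N * ‖T (formComponent j f)‖ + 2 * N * ‖T f‖ := by
    have h0 : 0 ≤ 2 * N * ‖T f‖ := mul_nonneg (by positivity) (norm_nonneg _)
    rintro (j | i | i)
    · exact (hmul f).trans (le_add_of_nonneg_right h0)
    · change ‖T (coordDeriv i (schwartzMul m f))‖ ≤ N * ‖T (coordDeriv i f)‖ + _
      rw [coordDeriv_schwartzMul, map_add]
      refine (norm_add_le _ _).trans (add_le_add (hmul _) (norm_toLp_le fun x => ?_))
      rw [schwartzMul_apply, norm_mul]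
      exact mul_le_mul_of_nonneg_right (hd i x) (norm_nonneg _)
    · have e : coordMul i (schwartzMul m f) = schwartzMul m (coordMul i f) := by
        have hx : (fun x : R3 => ((x i : ℝ) : ℂ)).HasTemperateGrowth :=
          (Complex.ofRealCLM.comp
            (EuclideanSpace.proj (𝕜 := ℝ) i : R3 →L[ℝ] ℝ)).hasTemperateGrowth
        ext x
        rw [schwartzMul_apply, coordMul, SchwartzMap.smulLeftCLM_apply_apply hx,
          SchwartzMap.smulLeftCLM_apply_apply hx, schwartzMul_apply, smul_eq_mul, smul_eq_mul]
        ring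
      change ‖T (coordMul i (schwartzMul m f))‖ ≤ N * ‖T (coordMul i f)‖ + _
      rw [e]
      exact (hmul _).trans (le_add_of_nonneg_right h0)
  have hreal : ∀ α β γ : ℝ, 0 ≤ γ → γ ≤ N * α + 2 * N * β →
      γ ^ 2 ≤ 2 * N ^ 2 * α ^ 2 + 8 * N ^ 2 * β ^ 2 := fun α β γ h0 h => by
    have h1 := pow_le_pow_left₀ h0 h 2
    nlinarith [sq_nonneg (N * α - 2 * N * β)]
  have hf : ‖T f‖ ^ 2 ≤ ‖schwartzForm f‖ ^ 2 := by
    have h0 : T f = T (formComponent (.inl ()) f) := rfl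
    have h1 : ∀ u : Unit ⊕ Fin 3 ⊕ Fin 3 → ℝ, u (.inl ()) ^ 2 ≤ ∑ j, u j ^ 2 := fun u =>
      Finset.single_le_sum (f := fun j => u j ^ 2) (fun j _ => sq_nonneg _) (Finset.mem_univ _)
    rw [norm_schwartzForm_sq, h0]
    exact h1 fun j => ‖T (formComponent j f)‖
  refine abs_le_of_sq_le_sq' ?_ (mul_nonneg (by positivity) (norm_nonneg _)) |>.2
  rw [norm_schwartzForm_sq (schwartzMul m f)]
  refine (Finset.sum_le_sum fun j _ => hreal _ _ _ (norm_nonneg _) (hcomp j)).trans ?_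
  rw [Finset.sum_add_distrib, ← Finset.mul_sum, ← norm_schwartzForm_sq, Finset.sum_const,
    Finset.card_univ]
  simp only [Fintype.card_sum, Fintype.card_unit, Fintype.card_fin, nsmul_eq_mul]
  have hfin : ∀ s t : ℝ, t ^ 2 ≤ s ^ 2 →
      2 * N ^ 2 * s ^ 2 + ((1 + (3 + 3) : ℕ) : ℝ) * (8 * N ^ 2 * t ^ 2) ≤ (8 * N * s) ^ 2 :=
    fun s t h => by
      have h1 := mul_le_mul_of_nonneg_left h (sq_nonneg N)
      have h2 := mul_nonneg (sq_nonneg N) (sq_nonneg s)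
      push_cast
      linarith
  exact hfin _ _ hf

/-- A vector is bounded by its inner products with a dense family. -/
lemma norm_le_of_denseRange {E ι : Type*} [NormedAddCommGroup E] [InnerProductSpace ℂ E]
    {s : ι → E} (hs : DenseRange s) {z : E} {C : ℝ} (hC : 0 ≤ C)
    (h : ∀ i, ‖⟪s i, z⟫_ℂ‖ ≤ C * ‖s i‖) :
    ‖z‖ ≤ C := by
  have h1 : ‖⟪z, z⟫_ℂ‖ ≤ C * ‖z‖ := hs.induction_on (p := fun F => ‖⟪F, z⟫_ℂ‖ ≤ C * ‖F‖) z
    (isClosed_le (by fun_prop) (by fun_prop)) h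
  rw [inner_self_eq_norm_sq_to_K, norm_pow, RCLike.norm_ofReal, abs_norm, sq] at h1
  rcases (norm_nonneg z).eq_or_lt with h0 | h0
  · rwa [← h0]
  · exact le_of_mul_le_mul_right h1 h0

/-- Multiplication by a bounded Lipschitz function preserves the domain of `Λ`:
`Λ φ Λ⁻¹` is the bounded operator `B`. -/
lemma exists_mulOp_mul_lamInv {φ : R3 → ℂ} {N : ℝ} (hN : 0 ≤ N) (hb : ∀ x, ‖φ x‖ ≤ N)
    (hl : ∀ x x', ‖φ x - φ x'‖ ≤ N * ‖x - x'‖) :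
    ∃ B : Op, ‖B‖ ≤ 8 * N ∧ mulOp φ * lamInv = lamInv * B := by
  obtain ⟨m, hmb, hmd, hm⟩ := exists_schwartz_approx hN hb hl
  have hφ := memLp_top_of_continuous (continuous_of_lipschitz hl) hb
  set M := mulOp φ with hM
  set J' := ContinuousLinearMap.adjoint formEmbed with hJ'
  have hS : ∀ (f : 𝓢(R3, ℂ)) (h : L2),
      ‖⟪M (formEmbed (schwartzForm f)), h⟫_ℂ‖ ≤ 8 * N * ‖schwartzForm f‖ * ‖J' h‖ := by
    intro f h
    have hle : ∀ k, ‖⟪formEmbed (schwartzForm (schwartzMul (m k) f)), h⟫_ℂ‖ ≤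
        8 * N * ‖schwartzForm f‖ * ‖J' h‖ := fun k => by
      rw [← ContinuousLinearMap.adjoint_inner_right]
      refine (norm_inner_le_norm _ _).trans (mul_le_mul_of_nonneg_right ?_ (norm_nonneg _))
      exact norm_schwartzForm_schwartzMul_le hN (hmb k) (hmd k) f
    -- the approximants converge only in `L²`, but their form norms are bounded
    have hlim : Tendsto (fun k => ⟪formEmbed (schwartzForm (schwartzMul (m k) f)), h⟫_ℂ) atTop
        (𝓝 ⟪M (formEmbed (schwartzForm f)), h⟫_ℂ) := by
      simp only [formEmbed_schwartzForm, MeasureTheory.L2.inner_def]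
      have hfL := f.coeFn_toLp 2 (volume : Measure R3)
      refine tendsto_integral_of_dominated_convergence (fun x => N * (‖f x‖ * ‖h x‖))
        (fun k => (MeasureTheory.L2.integrable_inner _ _).1) ?_ (fun k => ?_) ?_
      · exact ((f.memLp 2 volume).norm.integrable_mul (Lp.memLp h).norm).const_mul N
      · filter_upwards [(schwartzMul (m k) f).coeFn_toLp 2 (volume : Measure R3)] with x hx
        rw [SchwartzMap.toLpCLM_apply, hx, schwartzMul_apply]
        refine (norm_inner_le_norm _ _).trans ?_
        rw [norm_mul, mul_assoc]
        exact mul_le_mul_of_nonneg_right (hmb k x) (mul_nonneg (norm_nonneg _) (norm_nonneg _))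
      · have hall : ∀ᵐ x : R3, ∀ k, (schwartzMul (m k) f).toLp 2 (volume : Measure R3) x =
            schwartzMul (m k) f x :=
          ae_all_iff.2 fun k => (schwartzMul (m k) f).coeFn_toLp 2 (volume : Measure R3)
        filter_upwards [hall, hfL, mulOp_apply hφ (SchwartzMap.toLpCLM ℂ ℂ 2 volume f)]
          with x h1 h2 h3
        simp only [SchwartzMap.toLpCLM_apply] at h3 ⊢
        rw [h3, h2]
        simp only [h1, schwartzMul_apply]
        exact ((hm x).mul_const (f x)).inner tendsto_const_nhds
    exact le_of_tendsto hlim.norm (.of_forall hle)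
  have hbound : ∀ h : L2, ‖lamInv (ContinuousLinearMap.adjoint M h)‖ ≤ 8 * N * ‖lamInv h‖ := by
    intro h
    rw [norm_lamInv_apply, norm_lamInv_apply]
    refine norm_le_of_denseRange denseRange_schwartzForm
      (mul_nonneg (by positivity) (norm_nonneg _)) fun f => ?_
    rw [ContinuousLinearMap.adjoint_inner_right, ContinuousLinearMap.adjoint_inner_right]
    exact (hS f h).trans_eq (by ring)
  -- `Λ⁻¹ h ↦ Λ⁻¹ M* h` extends from the dense range of `Λ⁻¹` to the adjoint of `B`
  set K : Op := ((lamInv * ContinuousLinearMap.adjoint M : Op) : L2 →ₗ[ℂ] L2).extendOfNorm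
    (lamInv : L2 →ₗ[ℂ] L2) with hK
  have hKeq : K * lamInv = lamInv * ContinuousLinearMap.adjoint M := by
    ext1 h
    exact LinearMap.extendOfNorm_eq denseRange_lamInv ⟨8 * N, hbound⟩ h
  refine ⟨ContinuousLinearMap.adjoint K, ?_, ?_⟩
  · rw [LinearIsometryEquiv.norm_map]
    exact LinearMap.opNorm_extendOfNorm_le denseRange_lamInv (by positivity) hbound
  · have := congrArg star hKeq
    rw [star_mul, star_mul, isSelfAdjoint_lamInv.star_eq, ContinuousLinearMap.star_eq_adjoint,
      ContinuousLinearMap.star_eq_adjoint, ContinuousLinearMap.adjoint_adjoint] at this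
    exact this.symm

/-! ### The commutator with the Hartree potential -/

lemma norm_star_op (B : Op) : ‖star B‖ = ‖B‖ := by
  rw [ContinuousLinearMap.star_eq_adjoint]
  exact LinearIsometryEquiv.norm_map _ B

lemma IsSelfAdjointTraceClass.of_traceBound {τ : Op} {M : ℝ} (hs : IsSelfAdjoint τ)
    (h : TraceBound τ M) : IsSelfAdjointTraceClass τ :=
  ⟨hs, h.traceNorm_le.trans_lt ENNReal.ofReal_lt_top⟩

lemma IsSelfAdjointTraceClass.traceBound_mul {σ : Op} (hσ : IsSelfAdjointTraceClass σ) (B : Op) :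
    TraceBound (B * σ) (‖B‖ * (traceNorm σ).toReal) ∧
      TraceBound (σ * B) (‖B‖ * (traceNorm σ).toReal) := by
  obtain ⟨Q, T, hQ, hT, rfl, -, hQs, hTs⟩ := exists_hilbertSchmidt_factorization hσ.1
  set t := (traceNorm (Q * T)).toReal with ht
  have ht0 : 0 ≤ t := ENNReal.toReal_nonneg
  have hhs : ∀ R : Op, hsSq R = traceNorm (Q * T) → hsSq R ≤ ENNReal.ofReal (√t ^ 2) := by
    intro R hR
    rw [Real.sq_sqrt ht0, ENNReal.ofReal_toReal hσ.2.ne, hR]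
  have hBhs : ∀ B R : Op, hsSq R = traceNorm (Q * T) →
      hsSq (B * R) ≤ ENNReal.ofReal ((‖B‖ * √t) ^ 2) := by
    intro B R hR
    refine (hsSq_comp_left B R).trans ?_
    rw [mul_pow, ENNReal.ofReal_mul (by positivity), ENNReal.ofReal_pow (norm_nonneg _),
      ofReal_norm]
    exact mul_le_mul' le_rfl (hhs R hR)
  have hsq : √t * √t = t := Real.mul_self_sqrt ht0
  constructor
  · have := traceBound_mul_adjoint (mul_nonneg (norm_nonneg _) (Real.sqrt_nonneg _))
      (Real.sqrt_nonneg _) (hBhs B Q hQs) (hhs T hTs)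
    rwa [ContinuousLinearMap.isSelfAdjoint_iff'.1 hT, mul_assoc, mul_assoc, hsq] at this
  · have := traceBound_mul_adjoint (Real.sqrt_nonneg _)
      (mul_nonneg (norm_nonneg _) (Real.sqrt_nonneg _)) (hhs Q hQs) (hBhs (star B) T hTs)
    rwa [← ContinuousLinearMap.star_eq_adjoint, star_mul, star_star, hT.star_eq, ← mul_assoc,
      mul_left_comm, hsq, norm_star_op] at this

lemma IsSelfAdjointTraceClass.sub {σ τ : Op} (hσ : IsSelfAdjointTraceClass σ)
    (hτ : IsSelfAdjointTraceClass τ) : IsSelfAdjointTraceClass (σ - τ) := by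
  have h1 := (hσ.traceBound_mul 1).1
  have h2 := (hτ.traceBound_mul 1).1
  rw [one_mul] at h1 h2
  exact .of_traceBound (hσ.1.sub hτ.1) (h1.sub h2)

/-- The commutator of a real bounded Lipschitz function `φ` with `Λ⁻¹ σ Λ⁻¹` is
`Λ⁻¹ (B σ - σ B*) Λ⁻¹` with `B = Λ φ Λ⁻¹`. -/
lemma exists_commutator_eq_lamInv_conj {φ : R3 → ℂ} {N : ℝ} (hN : 0 ≤ N) (hr : star φ = φ)
    (hb : ∀ x, ‖φ x‖ ≤ N) (hl : ∀ x x', ‖φ x - φ x'‖ ≤ N * ‖x - x'‖) {σ : Op}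
    (hσ : IsSelfAdjointTraceClass σ) :
    ∃ τ : Op, mulOp φ * (lamInv * σ * lamInv) - lamInv * σ * lamInv * mulOp φ =
        lamInv * τ * lamInv ∧ star τ = -τ ∧ TraceBound τ (16 * N * (traceNorm σ).toReal) := by
  obtain ⟨B, hB, h1⟩ := exists_mulOp_mul_lamInv hN hb hl
  have hφ := memLp_top_of_continuous (continuous_of_lipschitz hl) hb
  have hsa : star (mulOp φ) = mulOp φ := by
    rw [ContinuousLinearMap.star_eq_adjoint, adjoint_mulOp hφ, hr]
  have h2 : lamInv * mulOp φ = star B * lamInv := by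
    have := congrArg star h1
    rwa [star_mul, star_mul, hsa, isSelfAdjoint_lamInv.star_eq] at this
  refine ⟨B * σ - σ * star B, ?_, ?_, ?_⟩
  · rw [mul_sub, sub_mul, mul_assoc _ lamInv (mulOp φ), h2, ← mul_assoc (mulOp φ),
      ← mul_assoc (mulOp φ), h1]
    simp only [mul_assoc]
  · rw [star_sub, star_mul, star_mul, star_star, hσ.1.star_eq, neg_sub]
  · have h3 := (hσ.traceBound_mul B).1.sub (hσ.traceBound_mul (star B)).2
    rw [norm_star_op] at h3
    intro W hW F
    refine (h3 W hW F).trans ?_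
    have := mul_le_mul_of_nonneg_right hB (ENNReal.toReal_nonneg (a := traceNorm σ))
    linarith

lemma isDensity_density_lamInv_conj {σ : Op} (hσ : IsSelfAdjointTraceClass σ) :
    IsDensity (lamInv * σ * lamInv) (density (lamInv * σ * lamInv)) := by
  obtain ⟨n, hn, -⟩ := exists_isDensity_lamInv_conj hσ
  exact isDensity_density hn

lemma hardyBound_density {σ : Op} (hσ : IsSelfAdjointTraceClass σ) :
    HardyBound (density (lamInv * σ * lamInv)) (traceNorm σ).toReal := by
  obtain ⟨n, hn, -, h1, h2⟩ := exists_isDensity_lamInv_conj hσ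
  have hd := isDensity_density hn
  have he := hd.ae_eq hn
  refine .of_lintegral hσ.2.ne hd.1.1 (le_trans (le_of_eq ?_) h1)
    fun x => le_trans (le_of_eq ?_) (h2 x)
  · refine lintegral_congr_ae ?_
    filter_upwards [he] with y hy
    rw [hy]
  · refine lintegral_congr_ae ?_
    filter_upwards [he] with y hy
    rw [hy]

lemma star_hartree {σ : Op} (hσ : IsSelfAdjointTraceClass σ) :
    star (hartree (lamInv * σ * lamInv)) = hartree (lamInv * σ * lamInv) := by
  obtain ⟨n, hn, hreal, -⟩ := exists_isDensity_lamInv_conj hσ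
  have he := (isDensity_density hn).ae_eq hn
  funext x
  rw [Pi.star_apply, hartree, star_mul', RCLike.star_def, ← integral_conj]
  congr 1
  · rw [map_inv₀, map_mul, Complex.conj_ofReal, map_ofNat]
  · refine integral_congr_ae ?_
    filter_upwards [he, hreal] with y h1 h2
    rw [map_div₀, Complex.conj_ofReal, h1, ← RCLike.star_def, h2]

lemma hartree_sub {σ₁ σ₂ : Op} (h₁ : IsSelfAdjointTraceClass σ₁)
    (h₂ : IsSelfAdjointTraceClass σ₂) :
    hartree (lamInv * (σ₁ - σ₂) * lamInv) =
      hartree (lamInv * σ₁ * lamInv) - hartree (lamInv * σ₂ * lamInv) := by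
  have hd := (isDensity_density_lamInv_conj h₁).sub (isDensity_density_lamInv_conj h₂)
  have e : lamInv * (σ₁ - σ₂) * lamInv = lamInv * σ₁ * lamInv - lamInv * σ₂ * lamInv := by
    rw [mul_sub, sub_mul]
  rw [← e] at hd
  funext x
  refine (congrFun (coulomb_congr_ae ((isDensity_density hd).ae_eq hd)) x).trans ?_
  rw [Pi.sub_apply, hartree, hartree, coulomb, ← mul_sub,
    ← integral_sub ((hardyBound_density h₁).integrable_div x)
      ((hardyBound_density h₂).integrable_div x)]
  simp only [Pi.sub_apply, sub_div]

lemma memLp_hartree {σ : Op} (hσ : IsSelfAdjointTraceClass σ) :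
    MemLp (hartree (lamInv * σ * lamInv)) ∞ volume :=
  memLp_top_of_continuous (continuous_of_lipschitz (hardyBound_density hσ).norm_coulomb_sub_le)
    (hardyBound_density hσ).norm_coulomb_le

/-- The commutator `[φ[ρ₁], ρ₂]` for `ρᵢ = Λ⁻¹ σᵢ Λ⁻¹`. -/
lemma exists_hartree_commutator {σ₁ σ₂ : Op} (h₁ : IsSelfAdjointTraceClass σ₁)
    (h₂ : IsSelfAdjointTraceClass σ₂) :
    ∃ τ : Op, mulOp (hartree (lamInv * σ₁ * lamInv)) * (lamInv * σ₂ * lamInv) -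
        lamInv * σ₂ * lamInv * mulOp (hartree (lamInv * σ₁ * lamInv)) = lamInv * τ * lamInv ∧
      star τ = -τ ∧ TraceBound τ (16 * (traceNorm σ₁).toReal * (traceNorm σ₂).toReal) :=
  exists_commutator_eq_lamInv_conj ENNReal.toReal_nonneg (star_hartree h₁)
    (hardyBound_density h₁).norm_coulomb_le (hardyBound_density h₁).norm_coulomb_sub_le h₂

end QDS

end

theorem mainTheorem8 :
    (∀ ρ ∈ QDS.energySpace,
      QDS.IsDensity ρ (QDS.density ρ) ∧
      (∀ x : QDS.R3, Integrable fun y : QDS.R3 => QDS.density ρ y / ((‖x - y‖ : ℝ) : ℂ)) ∧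
      MemLp (QDS.hartree ρ) ∞ volume ∧
      -Complex.I • QDS.hartreeCommutator ρ ∈ QDS.energySpace) ∧
    (∀ R : ℝ≥0, ∃ L : ℝ≥0, ∀ ρ₁ ∈ QDS.energySpace, ∀ ρ₂ ∈ QDS.energySpace,
      QDS.energyNorm ρ₁ ≤ R → QDS.energyNorm ρ₂ ≤ R →
      QDS.energyNorm
          (-Complex.I • QDS.hartreeCommutator ρ₁ - -Complex.I • QDS.hartreeCommutator ρ₂) ≤
        L * QDS.energyNorm (ρ₁ - ρ₂)) ∧
    (∃ C : ℝ≥0, ∀ ρ ∈ QDS.energySpace,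
      QDS.energyNorm (QDS.hartreeCommutator ρ) ≤ C * QDS.energyNorm ρ ^ 2) := by
  refine ⟨fun ρ hρ => ?_, fun R => ⟨32 * R, fun ρ₁ hρ₁ ρ₂ hρ₂ hR₁ hR₂ => ?_⟩,
    16, fun ρ hρ => ?_⟩
  · obtain ⟨σ, rfl, hσ⟩ := QDS.mem_energySpace_iff.1 hρ
    refine ⟨QDS.isDensity_density_lamInv_conj hσ, (QDS.hardyBound_density hσ).integrable_div,
      QDS.memLp_hartree hσ, ?_⟩
    obtain ⟨τ, hτ, hstar, hbound⟩ := QDS.exists_hartree_commutator hσ hσ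
    refine QDS.mem_energySpace_iff.2 ⟨-Complex.I • τ, ?_,
      .of_traceBound ?_ (hbound.smul (c := -Complex.I) (by simp))⟩
    · rw [QDS.hartreeCommutator, hτ, mul_smul_comm, smul_mul_assoc]
    · rw [IsSelfAdjoint, star_smul, hstar]
      simp
  · obtain ⟨σ₁, rfl, hσ₁⟩ := QDS.mem_energySpace_iff.1 hρ₁
    obtain ⟨σ₂, rfl, hσ₂⟩ := QDS.mem_energySpace_iff.1 hρ₂
    have hσ := hσ₁.sub hσ₂
    -- `[φ₁, ρ₁] - [φ₂, ρ₂] = [φ₁ - φ₂, ρ₁] + [φ₂, ρ₁ - ρ₂]`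
    obtain ⟨τ, hτ, -, hb⟩ := QDS.exists_hartree_commutator hσ hσ₁
    obtain ⟨τ', hτ', -, hb'⟩ := QDS.exists_hartree_commutator hσ₂ hσ
    rw [QDS.hartree_sub hσ₁ hσ₂, QDS.mulOp_sub (QDS.memLp_hartree hσ₁) (QDS.memLp_hartree hσ₂)]
      at hτ
    have e : QDS.lamInv * (σ₁ - σ₂) * QDS.lamInv =
        QDS.lamInv * σ₁ * QDS.lamInv - QDS.lamInv * σ₂ * QDS.lamInv := by
      rw [mul_sub, sub_mul]
    have hcomm : -Complex.I • QDS.hartreeCommutator (QDS.lamInv * σ₁ * QDS.lamInv) -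
        -Complex.I • QDS.hartreeCommutator (QDS.lamInv * σ₂ * QDS.lamInv) =
        QDS.lamInv * (-Complex.I • (τ + τ')) * QDS.lamInv := by
      rw [mul_smul_comm, smul_mul_assoc, mul_add, add_mul, ← hτ, ← hτ', e, ← smul_sub,
        QDS.hartreeCommutator, QDS.hartreeCommutator]
      congr 1
      simp only [mul_sub, sub_mul]
      abel
    rw [QDS.energyNorm_lamInv_conj] at hR₁ hR₂
    rw [hcomm, ← e, QDS.energyNorm_lamInv_conj, QDS.energyNorm_lamInv_conj]
    refine ((hb.add hb').smul (c := -Complex.I) (by simp)).traceNorm_le.trans ?_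
    have h1 : (QDS.traceNorm σ₁).toReal ≤ R := ENNReal.toReal_le_coe_of_le_coe hR₁
    have h2 : (QDS.traceNorm σ₂).toReal ≤ R := ENNReal.toReal_le_coe_of_le_coe hR₂
    have h0 : 0 ≤ (QDS.traceNorm (σ₁ - σ₂)).toReal := ENNReal.toReal_nonneg
    calc _ ≤ ENNReal.ofReal (32 * R * (QDS.traceNorm (σ₁ - σ₂)).toReal) := by
          refine ENNReal.ofReal_le_ofReal ?_
          nlinarith
      _ = _ := by
          rw [ENNReal.ofReal_mul (by positivity), ENNReal.ofReal_toReal hσ.2.ne,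
            ENNReal.ofReal_mul (by norm_num), ENNReal.ofReal_coe_nnreal]
          simp
  · obtain ⟨σ, rfl, hσ⟩ := QDS.mem_energySpace_iff.1 hρ
    obtain ⟨τ, hτ, -, hb⟩ := QDS.exists_hartree_commutator hσ hσ
    rw [QDS.hartreeCommutator, hτ, QDS.energyNorm_lamInv_conj, QDS.energyNorm_lamInv_conj]
    refine hb.traceNorm_le.trans_eq ?_
    rw [mul_assoc, ← sq, ENNReal.ofReal_mul (by norm_num), ENNReal.ofReal_pow
      ENNReal.toReal_nonneg, ENNReal.ofReal_toReal hσ.2.ne]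
    simp
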